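/- **The calculus.** Linearities are $Y\in\{\bullet,\circ\}$ (unlimited, linear). Types are given by value types $A,B::=\alpha\mid A\to^Y C\mid\forall^Y\alpha^K.C$; computation types $C,D::=A\,!\,E$; effect types $E::=\{R\}$; rows $R::=\ell:P;R\mid\mu\mid\cdot$; presence types $P::=\mathsf{Abs}\mid A\twoheadrightarrow^Y B\mid\theta$; handler types $C\rightrightarrows D$. Kinds are $K::=\mathsf{Type}^Y\mid\mathsf{Row}_{\mathcal L}^Y\mid\mathsf{Presence}^Y\mid\mathsf{Effect}\mid\mathsf{Comp}\mid\mathsf{Handler}$ with $\mathcal L$ a finite set of labels; type variables in types are of kind $\mathsf{Type}$, $\mathsf{Row}$ or $\mathsf{Presence}$. Types are identified up to reordering the distinct labels of a row and dropping labels $\ell:\mathsf{Abs}$ from rows that end in $\cdot$. Terms are $$V,W::=x\mid\lambda^Yx^A.M\mid\Lambda^Y\alpha^K.M\mid\lfloor V\rfloor,\qquad H::=\{\mathsf{return}\,x\mapsto M\}\mid\{\ell\,p\,r\mapsto M\}\uplus H,$$ $$M,N::=V\,W\mid V\,T\mid(\mathsf{return}\,V)^E\mid(\mathsf{do}\,\ell\,V)^E\mid\mathsf{let}^Y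 x\leftarrow M\ \mathsf{in}\ N\mid\mathsf{handle}\,M\,\mathsf{with}\,H,$$ where $\lfloor V\rfloor$ is a *tagged* value. **Kinding** $\Delta\vdash T:K$. Put $\bullet\le\circ$. Subkinding (with subsumption) is $\mathsf{Type}^Y\le\mathsf{Type}^{Y'}$ for $Y\le Y'$, and $\mathsf{Presence}^{Y}\le\mathsf{Presence}^{Y'}$, $\mathsf{Row}^Y_{\mathcal L}\le\mathsf{Row}^{Y'}_{\mathcal L}$ for $Y'\le Y$. For well-formed components, $A\to^YC$ and $\forall^Y\alpha^K.C$ have kind $\mathsf{Type}^Y$, $A\twoheadrightarrow^YB$ has kind $\mathsf{Presence}^Y$, $\mathsf{Abs}$ has kind $\mathsf{Presence}^Y$ and $\cdot$ has kind $\mathsf{Row}_{\mathcal L}^Y$ for all $Y,\mathcal L$; $\ell:P;R$ has kind $\mathsf{Row}^Y_{\mathcal L}$ if $\ell\notin\mathcal L$, $P:\mathsf{Presence}^Y$ and $R:\mathsf{Row}^Y_{\mathcal L\cup\{\ell\}}$; $\{R\}:\mathsf{Effect}$ if $R:\mathsf{Row}_\emptyset^Y$ for some $Y$; $A\,!\,E:\mathsf{Comp}$;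 $C\rightrightarrows D:\mathsf{Handler}$. $\Delta\vdash\Gamma:Y$ means that all types in $\Gamma$ have kind $\mathsf{Type}^Y$. $\Gamma=\Gamma_1+\Gamma_2$ is context splitting: each variable of $\Gamma$ goes to exactly one side, or to both if its type has kind $\mathsf{Type}^\bullet$. **Typing** (all types and contexts well formed; tags are ignored, i.e. $\lfloor V\rfloor:A$ iff $V:A$). - $\Delta;\Gamma,x:A\vdash x:A$ if $\Delta\vdash\Gamma:\bullet$. - $\Delta;\Gamma\vdash\lambda^Yx^A.M:A\to^YC$ if $\Delta\vdash\Gamma:Y$ and $\Delta;\Gamma,x:A\vdash M:C$; $\Delta;\Gamma\vdash\Lambda^Y\alpha^K.M:\forall^Y\alpha^K.C$ if $\Delta\vdash\Gamma:Y$, $\alpha\notin\mathrm{ftv}(\Gamma)$ and $\Delta,\alpha:K;\Gamma\vdash M:C$. - $\Gamma_1+\Gamma_2\vdash V\,W:C$ if $\Gamma_1\vdash V:A\to^YC$ and $\Gamma_2\vdash W:A$; $\Gamma\vdash V\,T:C[T/\alpha]$ if $\Gamma\vdash V:\forall^Y\alpha^K.C$ and $T:K$. - $\Gamma\vdash(\mathsf{return}\,V)^E:A\,!\,E$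 if $\Gamma\vdash V:A$; $\Gamma\vdash(\mathsf{do}\,\ell\,V)^E:B\,!\,E$ if $E=\{\ell:A\twoheadrightarrow^YB;R\}$ and $\Gamma\vdash V:A$. - $\Gamma_1+\Gamma_2\vdash\mathsf{let}^Yx\leftarrow M\ \mathsf{in}\ N:B\,!\,\{R\}$ if $\Gamma_1\vdash M:A\,!\,\{R\}$, $\Gamma_2,x:A\vdash N:B\,!\,\{R\}$, $\Delta\vdash\Gamma_2:Y$ and $\Delta\vdash R:\mathsf{Row}_\emptyset^Y$. - $\Gamma_1+\Gamma_2\vdash\mathsf{handle}\,M\,\mathsf{with}\,H:D$ if $\Gamma_1\vdash H:C\rightrightarrows D$ and $\Gamma_2\vdash M:C$. - $\Gamma\vdash\{\mathsf{return}\,x\mapsto M\}\uplus\{\ell_i\,p_i\,r_i\mapsto N_i\}_i:C\rightrightarrows D$ if $C=A\,!\,\{(\ell_i:A_i\twoheadrightarrow^{Y_i}B_i)_i;R\}$, $D=B\,!\,\{(\ell_i:P)_i;R\}$, $\Delta\vdash\Gamma:\bullet$, $\Gamma,x:A\vdash M:D$, and $\Gamma,p_i:A_i,r_i:B_i\to^{Y_i}D\vdash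 N_i:D$ for all $i$. **Linearity-aware semantics.** Evaluation contexts are $\mathcal E::=[\,]\mid\mathsf{let}^Yx\leftarrow\mathcal E\ \mathsf{in}\ N\mid\mathsf{handle}\,\mathcal E\,\mathsf{with}\,H$; $\mathrm{bl}(\mathcal E)$ is the set of labels handled by the handlers around the hole; tag-removing contexts are $\mathcal F::=[\,]\,W\mid[\,]\,T$. For closed $V$: if $\vdash V:A$ for some $A$ with $\nvdash A:\mathsf{Type}^\bullet$, and $V$ is not of the form $\lfloor W\rfloor$, then $\mathrm{tag}(V)=(\lfloor V\rfloor,\{\lfloor V\rfloor\})$; otherwise $\mathrm{tag}(V)=(V,\emptyset)$. Write $(V',S_V)=\mathrm{tag}(V)$. The relation $M\xrightarrow{S;T}N$ (introducing the multiset $S$ and eliminating the multiset $T$) on closed computations is generated by - $(\lambda^Yx^A.M)\,V\xrightarrow{S_V;\emptyset}M[V'/x]$; $\ (\Lambda^Y\alpha^K.M)\,T\xrightarrow{\emptyset;\emptyset}M[T/\alpha]$; $\ \mathsf{let}^Yx\leftarrow(\mathsf{return}\,V)^E\ \mathsf{in}\ N\xrightarrow{S_V;\emptyset}N[V'/x]$;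 - $\mathsf{handle}\,(\mathsf{return}\,V)^E\,\mathsf{with}\,H\xrightarrow{S_V;\emptyset}N[V'/x]$, where $(\mathsf{return}\,x\mapsto N)\in H$; - $\mathsf{handle}\,\mathcal E[(\mathsf{do}\,\ell\,V)^E]\,\mathsf{with}\,H\xrightarrow{S_V\cup S_W;\emptyset}N[V'/p,W'/r]$, where $\ell\notin\mathrm{bl}(\mathcal E)$, $(\ell\,p\,r\mapsto N)\in H$, $(\ell:A\twoheadrightarrow^YB)\in E$ and $W=\lambda^Yy^B.\mathsf{handle}\,\mathcal E[(\mathsf{return}\,y)^E]\,\mathsf{with}\,H$; - $\mathcal F[\lfloor V\rfloor]\xrightarrow{\emptyset;\{\lfloor V\rfloor\}}\mathcal F[V]$; $\ $ and $\mathcal E[M]\xrightarrow{S;T}\mathcal E[N]$ if $M\xrightarrow{S;T}N$. **Linear safety.** $\mathrm{TL}$ of a term or context is the multiset of all occurrences of tagged values in it ($\mathrm{TL}(\lfloor V\rfloor)=\{\lfloor V\rfloor\}\cup\mathrm{TL}(V)$, homomorphic otherwise; $\cup$ is the additive union of multisets). A well-typed computation $M$ is *linear safe* if 1. $\mathrm{TL}(W)=\emptyset$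 for every value subterm $W$ of the form $\lambda^\bullet x^A.N$ or $\Lambda^\bullet\alpha^K.N$, or with an unlimited type (a type of kind $\mathsf{Type}^\bullet$); 2. $\mathrm{TL}(\mathcal E)=\emptyset$ for every computation subterm $\mathcal E[(\mathsf{do}\,\ell\,V)^E]$ with $(\ell:A\twoheadrightarrow^\bullet B)\in E$ and $\ell\notin\mathrm{bl}(\mathcal E)$; 3. $\mathrm{TL}(H)=\emptyset$ for every handler subterm $H$. Consider also the condition 4. $\mathrm{TL}(N_2)=\emptyset$ for every subterm $\mathsf{let}^\bullet x\leftarrow N_1\ \mathsf{in}\ N_2$. **Theorem (Reduction Safety).** Let $M$ be a closed computation with $\vdash M:C$, in which tags are attached to closed values only, and let $M$ be linear safe. If $M\xrightarrow{S;T}N$, then $$\mathrm{TL}(M)\cup S=\mathrm{TL}(N)\cup T,$$ $\vdash N:C$, tags in $N$ are attached to closed values only, and $N$ satisfies 1 and 3. If moreover $M$ satisfies 4, then $N$ is linear safe and again satisfies 4. (Computations without tags satisfy 1-4, so no tagged linear value is ever duplicated or discarded when such a computation is run, even in the presence of multi-shot deep handlers.) -/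

import Mathlib

/-! The calculus with linear types, row-based effect types and deep effect handlers, in de Bruijn
style: type variables and term variables are two separate families of indices. -/

namespace FEff

/-- Operation labels: a countably infinite set with decidable equality. -/
abbrev Label := ℕ

/-- Linearities: `unl` is `•` (unlimited), `lin` is `∘` (linear). -/
inductive Lin
  | unl
  | lin
  deriving DecidableEq

/-- Kinds.  In `row L Y`, `L` is the set of labels that must not appear in the row. -/
inductive Kind
  | type (Y : Lin)
  | row (L : Finset Label) (Y : Lin)
  | pres (Y : Lin)
  | effect
  | comp
  | handler

/-- The kinds whose syntactic category contains type variables: value types, row types and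
presence types. -/
def Kind.HasVars : Kind → Prop
  | .type _ => True
  | .row _ _ => True
  | .pres _ => True
  | _ => False

/-- All types `T`; the syntactic categories are separated by the kinding rules below. -/
inductive Ty
  /-- type variable (of value, row or presence kind) -/
  | var (n : ℕ)
  /-- `A →^Y C` -/
  | arrow (Y : Lin) (A C : Ty)
  /-- `∀^Y α^K. C`, binding one type variable in `C` -/
  | all (Y : Lin) (K : Kind) (C : Ty)
  /-- `A ! E` -/
  | comp (A E : Ty)
  /-- `{R}` -/
  | eff (R : Ty)
  /-- the empty row -/
  | rowNil
  /-- `ℓ : P; R` -/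
  | rowCons (l : Label) (P R : Ty)
  /-- the presence type `Abs` -/
  | abs
  /-- the operation signature `A ↠^Y B` -/
  | op (Y : Lin) (A B : Ty)
  /-- `C ⇉ D` -/
  | handler (C D : Ty)

/-- Lifting of a renaming of indices under a binder. -/
def upRen (ξ : ℕ → ℕ) : ℕ → ℕ
  | 0 => 0
  | n + 1 => ξ n + 1

namespace Ty

def rename : (ℕ → ℕ) → Ty → Ty
  | ξ, var n => var (ξ n)
  | ξ, arrow Y A C => arrow Y (rename ξ A) (rename ξ C)
  | ξ, all Y K C => all Y K (rename (upRen ξ) C)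
  | ξ, comp A E => comp (rename ξ A) (rename ξ E)
  | ξ, eff R => eff (rename ξ R)
  | _, rowNil => rowNil
  | ξ, rowCons l P R => rowCons l (rename ξ P) (rename ξ R)
  | _, abs => abs
  | ξ, op Y A B => op Y (rename ξ A) (rename ξ B)
  | ξ, handler C D => handler (rename ξ C) (rename ξ D)

/-- Lifting of a type substitution under a type binder. -/
def upSubst (σ : ℕ → Ty) : ℕ → Ty
  | 0 => var 0
  | n + 1 => rename Nat.succ (σ n)

/-- Simultaneous capture-avoiding substitution. -/
def subst : (ℕ → Ty) → Ty → Ty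
  | σ, var n => σ n
  | σ, arrow Y A C => arrow Y (subst σ A) (subst σ C)
  | σ, all Y K C => all Y K (subst (upSubst σ) C)
  | σ, comp A E => comp (subst σ A) (subst σ E)
  | σ, eff R => eff (subst σ R)
  | _, rowNil => rowNil
  | σ, rowCons l P R => rowCons l (subst σ P) (subst σ R)
  | _, abs => abs
  | σ, op Y A B => op Y (subst σ A) (subst σ B)
  | σ, handler C D => handler (subst σ C) (subst σ D)

/-- The substitution replacing variable `0` by `T` and lowering all other variables. -/
def single (T : Ty) : ℕ → Ty
  | 0 => T
  | n + 1 => var n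

/-- `C.inst T` is `C[T/α]`, where `α` is the variable `0` of `C`. -/
def inst (C T : Ty) : Ty := subst (single T) C

/-- Rows that end in the empty row, rather than in a row variable. -/
inductive IsClosedRow : Ty → Prop
  | nil : IsClosedRow rowNil
  | cons {l P R} : IsClosedRow R → IsClosedRow (rowCons l P R)

/-- `RowMem l P R`: the row `R` contains the entry `l : P`. -/
inductive RowMem (l : Label) (P : Ty) : Ty → Prop
  | here {R} : RowMem l P (rowCons l P R)
  | there {l' P' R} : RowMem l P R → RowMem l P (rowCons l' P' R)

/-- `HasOp E l Y A B`: the effect type `E` contains `l : A ↠^Y B`. -/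
def HasOp (E : Ty) (l : Label) (Y : Lin) (A B : Ty) : Prop :=
  ∃ R, E = eff R ∧ RowMem l (op Y A B) R

/-- Identification of types: the least congruence for which the order of the (distinct) labels of
a row is irrelevant and absent labels in closed rows are ignored. -/
inductive Eqv : Ty → Ty → Prop
  | refl (T) : Eqv T T
  | symm {T U} : Eqv T U → Eqv U T
  | trans {T U V} : Eqv T U → Eqv U V → Eqv T V
  | arrow {Y A A' C C'} : Eqv A A' → Eqv C C' → Eqv (arrow Y A C) (arrow Y A' C')
  | all {Y K C C'} : Eqv C C' → Eqv (all Y K C) (all Y K C')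
  | comp {A A' E E'} : Eqv A A' → Eqv E E' → Eqv (comp A E) (comp A' E')
  | eff {R R'} : Eqv R R' → Eqv (eff R) (eff R')
  | rowCons {l P P' R R'} : Eqv P P' → Eqv R R' → Eqv (rowCons l P R) (rowCons l P' R')
  | op {Y A A' B B'} : Eqv A A' → Eqv B B' → Eqv (op Y A B) (op Y A' B')
  | handler {C C' D D'} : Eqv C C' → Eqv D D' → Eqv (handler C D) (handler C' D')
  | swap {l l' P P' R} : l ≠ l' →
      Eqv (rowCons l P (rowCons l' P' R)) (rowCons l' P' (rowCons l P R))
  | absent {l R} : IsClosedRow R → Eqv (rowCons l abs R) R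

/-- The row `(ℓᵢ : Aᵢ ↠^{Yᵢ} Bᵢ)ᵢ; R`. -/
def opsRow : List (Label × Lin × Ty × Ty) → Ty → Ty
  | [], R => R
  | (l, Y, A, B) :: sigs, R => rowCons l (op Y A B) (opsRow sigs R)

/-- The row `(ℓᵢ : P)ᵢ; R`, with the labels of the given signatures. -/
def presRow : List (Label × Lin × Ty × Ty) → Ty → Ty → Ty
  | [], _, R => R
  | (l, _, _, _) :: sigs, P, R => rowCons l P (presRow sigs P R)

end Ty

/-- `Y ≤ Y'`, generated by `• ≤ ∘`. -/
inductive Lin.Le : Lin → Lin → Prop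
  | refl (Y) : Lin.Le Y Y
  | unl_lin : Lin.Le .unl .lin

/-- Subkinding: covariant for value types, contravariant for presence and row types. -/
inductive Kind.Sub : Kind → Kind → Prop
  | type {Y Y'} : Lin.Le Y Y' → Kind.Sub (.type Y) (.type Y')
  | pres {Y Y'} : Lin.Le Y' Y → Kind.Sub (.pres Y) (.pres Y')
  | row {L Y Y'} : Lin.Le Y' Y → Kind.Sub (.row L Y) (.row L Y')

/-- Kind contexts: the kind of type variable `n` is the `n`-th entry. -/
abbrev KCtx := List Kind

/-- The kinding judgement `Δ ⊢ T : K`. -/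
inductive Kinding : KCtx → Ty → Kind → Prop
  | var {Δ n K} : Δ[n]? = some K → K.HasVars → Kinding Δ (.var n) K
  | all {Δ Y K C} : Kinding (K :: Δ) C .comp → Kinding Δ (.all Y K C) (.type Y)
  | arrow {Δ Y Y' A C} : Kinding Δ A (.type Y') → Kinding Δ C .comp →
      Kinding Δ (.arrow Y A C) (.type Y)
  | comp {Δ Y A E} : Kinding Δ A (.type Y) → Kinding Δ E .effect → Kinding Δ (.comp A E) .comp
  | eff {Δ R Y} : Kinding Δ R (.row ∅ Y) → Kinding Δ (.eff R) .effect
  | op {Δ Y Y₁ Y₂ A B} : Kinding Δ A (.type Y₁) → Kinding Δ B (.type Y₂) →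
      Kinding Δ (.op Y A B) (.pres Y)
  | abs {Δ Y} : Kinding Δ .abs (.pres Y)
  | rowNil {Δ L Y} : Kinding Δ .rowNil (.row L Y)
  | rowCons {Δ l P R L Y} : Kinding Δ P (.pres Y) → l ∉ L → Kinding Δ R (.row (insert l L) Y) →
      Kinding Δ (.rowCons l P R) (.row L Y)
  | handler {Δ C D} : Kinding Δ C .comp → Kinding Δ D .comp → Kinding Δ (.handler C D) .handler
  | upcast {Δ T K K'} : Kinding Δ T K → Kind.Sub K K' → Kinding Δ T K'

/-! ### Terms -/

mutual
/-- Values, including values carrying a linear tag. -/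
inductive Val
  | var (n : ℕ)
  /-- `λ^Y x^A. M` -/
  | lam (Y : Lin) (A : Ty) (M : Comp)
  /-- `Λ^Y α^K. M` -/
  | tlam (Y : Lin) (K : Kind) (M : Comp)
  /-- the tagged value `⌊V⌋` -/
  | tag (V : Val)
/-- Computations. -/
inductive Comp
  | app (V W : Val)
  | tapp (V : Val) (T : Ty)
  /-- `(return V)^E` -/
  | ret (V : Val) (E : Ty)
  /-- `(do l V)^E` -/
  | perform (l : Label) (V : Val) (E : Ty)
  /-- `let^Y x ← M in N`, binding `x` in `N` -/
  | bind (Y : Lin) (M N : Comp)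
  /-- `handle M with H` -/
  | handle (M : Comp) (H : Hnd)
/-- Handlers. -/
inductive Hnd
  /-- `{return x ↦ M}`, binding `x` in `M` -/
  | ret (M : Comp)
  /-- `{l p r ↦ M} ⊎ H`, binding `p` (index `1`) and `r` (index `0`) in `M` -/
  | op (l : Label) (M : Comp) (H : Hnd)
end

mutual
/-- Renaming of type variables (by `ζ`) and term variables (by `ξ`). -/
def Val.rename : (ℕ → ℕ) → (ℕ → ℕ) → Val → Val
  | _, ξ, .var n => .var (ξ n)
  | ζ, ξ, .lam Y A M => .lam Y (A.rename ζ) (M.rename ζ (upRen ξ))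
  | ζ, ξ, .tlam Y K M => .tlam Y K (M.rename (upRen ζ) ξ)
  | ζ, ξ, .tag V => .tag (V.rename ζ ξ)
def Comp.rename : (ℕ → ℕ) → (ℕ → ℕ) → Comp → Comp
  | ζ, ξ, .app V W => .app (V.rename ζ ξ) (W.rename ζ ξ)
  | ζ, ξ, .tapp V T => .tapp (V.rename ζ ξ) (T.rename ζ)
  | ζ, ξ, .ret V E => .ret (V.rename ζ ξ) (E.rename ζ)
  | ζ, ξ, .perform l V E => .perform l (V.rename ζ ξ) (E.rename ζ)
  | ζ, ξ, .bind Y M N => .bind Y (M.rename ζ ξ) (N.rename ζ (upRen ξ))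
  | ζ, ξ, .handle M H => .handle (M.rename ζ ξ) (H.rename ζ ξ)
def Hnd.rename : (ℕ → ℕ) → (ℕ → ℕ) → Hnd → Hnd
  | ζ, ξ, .ret M => .ret (M.rename ζ (upRen ξ))
  | ζ, ξ, .op l M H => .op l (M.rename ζ (upRen (upRen ξ))) (H.rename ζ ξ)
end

/-- Lifting of a value substitution under a term binder. -/
def upVal (σ : ℕ → Val) : ℕ → Val
  | 0 => .var 0
  | n + 1 => (σ n).rename id Nat.succ

/-- Lifting of a value substitution under a type binder. -/
def tupVal (σ : ℕ → Val) : ℕ → Val := fun n => (σ n).rename Nat.succ id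

mutual
/-- Simultaneous capture-avoiding substitution for type variables (by `τ`) and term variables
(by `σ`). -/
def Val.subst : (ℕ → Ty) → (ℕ → Val) → Val → Val
  | _, σ, .var n => σ n
  | τ, σ, .lam Y A M => .lam Y (A.subst τ) (M.subst τ (upVal σ))
  | τ, σ, .tlam Y K M => .tlam Y K (M.subst (Ty.upSubst τ) (tupVal σ))
  | τ, σ, .tag V => .tag (V.subst τ σ)
def Comp.subst : (ℕ → Ty) → (ℕ → Val) → Comp → Comp
  | τ, σ, .app V W => .app (V.subst τ σ) (W.subst τ σ)
  | τ, σ, .tapp V T => .tapp (V.subst τ σ) (T.subst τ)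
  | τ, σ, .ret V E => .ret (V.subst τ σ) (E.subst τ)
  | τ, σ, .perform l V E => .perform l (V.subst τ σ) (E.subst τ)
  | τ, σ, .bind Y M N => .bind Y (M.subst τ σ) (N.subst τ (upVal σ))
  | τ, σ, .handle M H => .handle (M.subst τ σ) (H.subst τ σ)
def Hnd.subst : (ℕ → Ty) → (ℕ → Val) → Hnd → Hnd
  | τ, σ, .ret M => .ret (M.subst τ (upVal σ))
  | τ, σ, .op l M H => .op l (M.subst τ (upVal (upVal σ))) (H.subst τ σ)
end

/-- The substitution `[V/0]`. -/
def single (V : Val) : ℕ → Val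
  | 0 => V
  | n + 1 => .var n

/-- The substitution `[W/0, V/1]`. -/
def double (V W : Val) : ℕ → Val
  | 0 => W
  | 1 => V
  | n + 2 => .var n

/-- `M[V/x]`, where `x` is the term variable `0`. -/
def Comp.inst (M : Comp) (V : Val) : Comp := M.subst Ty.var (single V)

/-- `M[V/p, W/r]`, where `p` is the term variable `1` and `r` the term variable `0`. -/
def Comp.inst₂ (M : Comp) (V W : Val) : Comp := M.subst Ty.var (double V W)

/-- `M[T/α]`, where `α` is the type variable `0`. -/
def Comp.tinst (M : Comp) (T : Ty) : Comp := M.subst (Ty.single T) Val.var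

/-! ### Typing -/

/-- Type contexts.  The `n`-th entry is `some A` if term variable `n` is in the context with type
`A`, and `none` if that variable has been given away by context splitting. -/
abbrev Ctx := List (Option Ty)

/-- Weakening of a type context by one type variable. -/
def Ctx.tshift (Γ : Ctx) : Ctx := Γ.map (Option.map (Ty.rename Nat.succ))

/-- `Δ ⊢ Γ : Y`. -/
def CtxLin (Δ : KCtx) (Γ : Ctx) (Y : Lin) : Prop :=
  ∀ A, some A ∈ Γ → Kinding Δ A (.type Y)

/-- Context splitting `Δ ⊢ Γ = Γ₁ + Γ₂`. -/
inductive Split (Δ : KCtx) : Ctx → Ctx → Ctx → Prop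
  | nil : Split Δ [] [] []
  | none {Γ Γ₁ Γ₂} : Split Δ Γ Γ₁ Γ₂ → Split Δ (none :: Γ) (none :: Γ₁) (none :: Γ₂)
  | unl {Γ Γ₁ Γ₂ A} : Kinding Δ A (.type .unl) → Split Δ Γ Γ₁ Γ₂ →
      Split Δ (some A :: Γ) (some A :: Γ₁) (some A :: Γ₂)
  | linLeft {Γ Γ₁ Γ₂ A} : Kinding Δ A (.type .lin) → Split Δ Γ Γ₁ Γ₂ →
      Split Δ (some A :: Γ) (some A :: Γ₁) (.none :: Γ₂)
  | linRight {Γ Γ₁ Γ₂ A} : Kinding Δ A (.type .lin) → Split Δ Γ Γ₁ Γ₂ →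
      Split Δ (some A :: Γ) (.none :: Γ₁) (some A :: Γ₂)

mutual
/-- `Δ; Γ ⊢ V : A`.  Tags are ignored. -/
inductive ValTy : KCtx → Ctx → Val → Ty → Prop
  | var {Δ Γ n A} : Γ[n]? = some (some A) → Kinding Δ A (.type .lin) →
      (∀ m B, m ≠ n → Γ[m]? = some (some B) → Kinding Δ B (.type .unl)) →
      ValTy Δ Γ (.var n) A
  | lam {Δ Γ Y Y' A M C} : CtxLin Δ Γ Y → Kinding Δ A (.type Y') →
      CompTy Δ (some A :: Γ) M C → ValTy Δ Γ (.lam Y A M) (.arrow Y A C)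
  | tlam {Δ Γ Y K M C} : CtxLin Δ Γ Y → CompTy (K :: Δ) (Ctx.tshift Γ) M C →
      ValTy Δ Γ (.tlam Y K M) (.all Y K C)
  | tag {Δ Γ V A} : ValTy Δ Γ V A → ValTy Δ Γ (.tag V) A
  /-- types are identified up to `Ty.Eqv` -/
  | conv {Δ Γ V A B Y} : ValTy Δ Γ V A → Ty.Eqv A B → Kinding Δ B (.type Y) → ValTy Δ Γ V B
/-- `Δ; Γ ⊢ M : C`. -/
inductive CompTy : KCtx → Ctx → Comp → Ty → Prop
  | app {Δ Γ Γ₁ Γ₂ V W Y A C} : Split Δ Γ Γ₁ Γ₂ → ValTy Δ Γ₁ V (.arrow Y A C) →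
      ValTy Δ Γ₂ W A → CompTy Δ Γ (.app V W) C
  | tapp {Δ Γ V Y K C T} : ValTy Δ Γ V (.all Y K C) → Kinding Δ T K →
      CompTy Δ Γ (.tapp V T) (C.inst T)
  | ret {Δ Γ V A E} : ValTy Δ Γ V A → Kinding Δ E .effect → CompTy Δ Γ (.ret V E) (.comp A E)
  | perform {Δ Γ l V Y A B R E} : Ty.Eqv E (.eff (.rowCons l (.op Y A B) R)) →
      Kinding Δ (.eff (.rowCons l (.op Y A B) R)) .effect → Kinding Δ E .effect →
      ValTy Δ Γ V A → CompTy Δ Γ (.perform l V E) (.comp B E)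
  | bind {Δ Γ Γ₁ Γ₂ Y M N A B R} : Split Δ Γ Γ₁ Γ₂ → CompTy Δ Γ₁ M (.comp A (.eff R)) →
      CompTy Δ (some A :: Γ₂) N (.comp B (.eff R)) → CtxLin Δ Γ₂ Y → Kinding Δ R (.row ∅ Y) →
      CompTy Δ Γ (.bind Y M N) (.comp B (.eff R))
  | handle {Δ Γ Γ₁ Γ₂ M H C D} : Split Δ Γ Γ₁ Γ₂ → HndTy Δ Γ₁ H C D → CompTy Δ Γ₂ M C →
      CompTy Δ Γ (.handle M H) D
  /-- types are identified up to `Ty.Eqv` -/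
  | conv {Δ Γ M C D} : CompTy Δ Γ M C → Ty.Eqv C D → Kinding Δ D .comp → CompTy Δ Γ M D
/-- `Δ; Γ ⊢ H : C ⇉ D`, where `C = A ! {(ℓᵢ : Aᵢ ↠^{Yᵢ} Bᵢ)ᵢ; R}` and `D = B ! {(ℓᵢ : P)ᵢ; R}`. -/
inductive HndTy : KCtx → Ctx → Hnd → Ty → Ty → Prop
  | handler {Δ Γ H A B sigs P R} : CtxLin Δ Γ .unl →
      Kinding Δ (.comp A (.eff (Ty.opsRow sigs R))) .comp →
      Kinding Δ (.comp B (.eff (Ty.presRow sigs P R))) .comp →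
      ClausesTy Δ Γ H A sigs (.comp B (.eff (Ty.presRow sigs P R))) →
      HndTy Δ Γ H (.comp A (.eff (Ty.opsRow sigs R))) (.comp B (.eff (Ty.presRow sigs P R)))
/-- The clauses of `H` have type `D`, where the return clause takes an argument of type `A` and the
operation clauses handle exactly the operations with the listed signatures `(ℓᵢ, Yᵢ, Aᵢ, Bᵢ)`. -/
inductive ClausesTy : KCtx → Ctx → Hnd → Ty → List (Label × Lin × Ty × Ty) → Ty → Prop
  | ret {Δ Γ M A D} : CompTy Δ (some A :: Γ) M D → ClausesTy Δ Γ (.ret M) A [] D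
  | op {Δ Γ l N H A Y A' B' sigs D} :
      CompTy Δ (some (.arrow Y B' D) :: some A' :: Γ) N D → ClausesTy Δ Γ H A sigs D →
      ClausesTy Δ Γ (.op l N H) A ((l, Y, A', B') :: sigs) D
end

/-! ### Linearity-aware small-step semantics -/

/-- `H.retBody` is the `N` with `(return x ↦ N) ∈ H`. -/
def Hnd.retBody : Hnd → Comp
  | .ret M => M
  | .op _ _ H => H.retBody

/-- `H.HasClause l N`: `(l p r ↦ N) ∈ H`. -/
def Hnd.HasClause : Hnd → Label → Comp → Prop
  | .ret _, _, _ => False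
  | .op l M H, l', N => (l = l' ∧ M = N) ∨ H.HasClause l' N

/-- The set of operation labels that `H` handles. -/
def Hnd.dom : Hnd → Finset Label
  | .ret _ => ∅
  | .op l _ H => insert l H.dom

/-- Evaluation contexts. -/
inductive ECtx
  | hole
  | bind (Y : Lin) (E : ECtx) (N : Comp)
  | handle (E : ECtx) (H : Hnd)

/-- `𝓔[M]`. -/
def ECtx.plug : ECtx → Comp → Comp
  | .hole, M => M
  | .bind Y E N, M => .bind Y (E.plug M) N
  | .handle E H, M => .handle (E.plug M) H

/-- The weakening of an evaluation context by one term variable. -/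
def ECtx.shift : ECtx → ECtx
  | .hole => .hole
  | .bind Y E N => .bind Y E.shift (N.rename id (upRen Nat.succ))
  | .handle E H => .handle E.shift (H.rename id Nat.succ)

/-- The bound labels of an evaluation context. -/
def ECtx.bl : ECtx → Finset Label
  | .hole => ∅
  | .bind _ E _ => E.bl
  | .handle E H => E.bl ∪ H.dom

/-- Tag-removing contexts `[ ] W` and `[ ] T`. -/
inductive FCtx
  | app (W : Val)
  | tapp (T : Ty)

def FCtx.plug : FCtx → Val → Comp
  | .app W, V => .app V W
  | .tapp T, V => .tapp V T

/-- `lin(V)`, for closed `V`. -/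
def Val.IsLin (V : Val) : Prop := ∃ A, ValTy [] [] V A ∧ ¬ Kinding [] A (.type .unl)

open Classical in
/-- `tag(V)`, for closed `V`. -/
noncomputable def Val.mark (V : Val) : Val × Multiset Val :=
  if V.IsLin ∧ ∀ W, V ≠ .tag W then (.tag V, {.tag V}) else (V, 0)

/-- `Step M S T N`: the closed computation `M` steps to `N`, introducing the multiset `S` of tagged
linear values and eliminating the multiset `T`. -/
inductive Step : Comp → Multiset Val → Multiset Val → Comp → Prop
  | app {Y A M V} : Step (.app (.lam Y A M) V) V.mark.2 0 (M.inst V.mark.1)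
  | tapp {Y K M T} : Step (.tapp (.tlam Y K M) T) 0 0 (M.tinst T)
  | seq {Y V E N} : Step (.bind Y (.ret V E) N) V.mark.2 0 (N.inst V.mark.1)
  | ret {V E H} : Step (.handle (.ret V E) H) V.mark.2 0 (H.retBody.inst V.mark.1)
  | op {𝓔 : ECtx} {l V E H N Y A B W} : l ∉ 𝓔.bl → H.HasClause l N → E.HasOp l Y A B →
      W = Val.lam Y B (.handle (𝓔.shift.plug (.ret (.var 0) E)) (H.rename id Nat.succ)) →
      Step (.handle (𝓔.plug (.perform l V E)) H) (V.mark.2 + W.mark.2) 0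
        (N.inst₂ V.mark.1 W.mark.1)
  | remove {F : FCtx} {V} : Step (F.plug (.tag V)) 0 {.tag V} (F.plug V)
  | lift {𝓔 : ECtx} {M S T N} : Step M S T N → Step (𝓔.plug M) S T (𝓔.plug N)

/-! ### Tagged linear values and linear safety -/

mutual
/-- The multiset of tagged values occurring in a value. -/
def Val.tl : Val → Multiset Val
  | .var _ => 0
  | .lam _ _ M => M.tl
  | .tlam _ _ M => M.tl
  | .tag V => {.tag V} + V.tl
def Comp.tl : Comp → Multiset Val
  | .app V W => V.tl + W.tl
  | .tapp V _ => V.tl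
  | .ret V _ => V.tl
  | .perform _ V _ => V.tl
  | .bind _ M N => M.tl + N.tl
  | .handle M H => M.tl + H.tl
def Hnd.tl : Hnd → Multiset Val
  | .ret M => M.tl
  | .op _ M H => M.tl + H.tl
end

def ECtx.tl : ECtx → Multiset Val
  | .hole => 0
  | .bind _ E N => E.tl + N.tl
  | .handle E H => E.tl + H.tl

/-- Values, computations and handlers taken together. -/
inductive Term
  | val (V : Val)
  | comp (M : Comp)
  | hnd (H : Hnd)

/-- `Child s t`: `s` is an immediate subterm of `t`. -/
inductive Term.Child : Term → Term → Prop
  | lam {Y A M} : Child (.comp M) (.val (.lam Y A M))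
  | tlam {Y K M} : Child (.comp M) (.val (.tlam Y K M))
  | tag {V} : Child (.val V) (.val (.tag V))
  | app_left {V W} : Child (.val V) (.comp (.app V W))
  | app_right {V W} : Child (.val W) (.comp (.app V W))
  | tapp {V T} : Child (.val V) (.comp (.tapp V T))
  | ret {V E} : Child (.val V) (.comp (.ret V E))
  | perform {l V E} : Child (.val V) (.comp (.perform l V E))
  | bind_left {Y M N} : Child (.comp M) (.comp (.bind Y M N))
  | bind_right {Y M N} : Child (.comp N) (.comp (.bind Y M N))
  | handle_left {M H} : Child (.comp M) (.comp (.handle M H))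
  | handle_right {M H} : Child (.hnd H) (.comp (.handle M H))
  | hret {M} : Child (.comp M) (.hnd (.ret M))
  | hop {l M H} : Child (.comp M) (.hnd (.op l M H))
  | hrest {l M H} : Child (.hnd H) (.hnd (.op l M H))

/-- `Sub s t`: `s` is a (not necessarily proper) subterm of `t`. -/
def Term.Sub : Term → Term → Prop := Relation.ReflTransGen Term.Child

/-- A value that is claimed to be unlimited: it has the form `λ^• x^A. N` or `Λ^• α^K. N`, or it
has an unlimited type. -/
def Val.IsUnl (W : Val) : Prop :=
  (∃ A N, W = .lam .unl A N) ∨ (∃ K N, W = .tlam .unl K N) ∨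
    ∃ Δ Γ A, ValTy Δ Γ W A ∧ Kinding Δ A (.type .unl)

/-- No tagged value occurs in an unlimited value. -/
def Comp.UnlimitedValuesSafe (M : Comp) : Prop :=
  ∀ W : Val, Term.Sub (.val W) (.comp M) → W.IsUnl → W.tl = 0

/-- No tagged value occurs in an evaluation context around an unhandled operation that is
control-flow unlimited. -/
def Comp.UnlimitedContextsSafe (M : Comp) : Prop :=
  ∀ (𝓔 : ECtx) (l : Label) (V : Val) (E A B : Ty),
    Term.Sub (.comp (𝓔.plug (.perform l V E))) (.comp M) → E.HasOp l .unl A B → l ∉ 𝓔.bl →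
      𝓔.tl = 0

/-- No tagged value occurs in a handler. -/
def Comp.HandlersSafe (M : Comp) : Prop :=
  ∀ H : Hnd, Term.Sub (.hnd H) (.comp M) → H.tl = 0

/-- Linear safety of a (well-typed) computation. -/
structure Comp.LinearSafe (M : Comp) : Prop where
  values : M.UnlimitedValuesSafe
  contexts : M.UnlimitedContextsSafe
  handlers : M.HandlersSafe

/-- No tagged value occurs in the continuation `N₂` of a sequencing `let^• x ← N₁ in N₂` that is
annotated as control-flow unlimited. -/
def Comp.UnlimitedLetsSafe (M : Comp) : Prop :=
  ∀ N₁ N₂ : Comp, Term.Sub (.comp (.bind .unl N₁ N₂)) (.comp M) → N₂.tl = 0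

/-- Tags are attached to closed (well-typed) values only. -/
def Comp.TagsClosed (M : Comp) : Prop :=
  ∀ V : Val, Term.Sub (.val (.tag V)) (.comp M) → ∃ A, ValTy [] [] V A

end FEff

/-!
Linear safety is recast as tag-safety, an invariant defined by recursion on the term: tags sit on
closed values that have no unlimited type, and no tagged value occurs in an unlimited abstraction or
in a handler.  Substituting closed tag-safe values for the variables of a context `Γ` adds exactly
the tagged values of the substituted values: context splitting sends a variable to both sides, and
the variable rule drops one, only if its type is unlimited, and closed tag-safe values of unlimited
type contain no tags.  For the same reason tag-safety is stable under substitution, as unlimited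
abstractions and handlers are typed in unlimited contexts.

A beta-like step substitutes a marked value, and marking adds to the tagged values exactly what the
step introduces.  When an operation is handled, its resumption contains the captured evaluation
context; if the operation is unlimited, so is the resumption, and condition 2 says that this context
has no tags.

Condition 2 itself is not preserved by reduction.  With condition 4 it follows from typing: a
sequencing `let^Y` requires its row to have kind `Row^Y`, and a row of kind `Row^∘` contains no
unlimited operation.  So every sequencing between an unlimited operation and its handler is
unlimited, and its continuation has no tags.
-/

namespace FEff

/-! ### Linearities and kinding -/

theorem Lin.Le.trans {X Y Z : Lin} (h : Lin.Le X Y) (h' : Lin.Le Y Z) : Lin.Le X Z := by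
  cases h <;> cases h' <;> constructor

theorem Lin.Le.eq_unl {Y : Lin} (h : Lin.Le Y .unl) : Y = .unl := by
  cases h; rfl

theorem Lin.unl_le (Y : Lin) : Lin.Le .unl Y := by
  cases Y <;> constructor

theorem Lin.le_lin (Y : Lin) : Lin.Le Y .lin := by
  cases Y <;> constructor

namespace Kinding

variable {Δ : KCtx} {A B C E P R : Ty} {K K' : Kind} {Y : Lin}

theorem to_lin (h : Kinding Δ A (.type Y)) : Kinding Δ A (.type .lin) :=
  .upcast h (.type Y.le_lin)

theorem of_unl (h : Kinding Δ A (.type .unl)) (Y : Lin) : Kinding Δ A (.type Y) :=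
  .upcast h (.type Y.unl_le)

theorem arrow_inv (h : Kinding Δ (.arrow Y A C) K) :
    (∃ Y', K = .type Y' ∧ Lin.Le Y Y') ∧ Kinding Δ A (.type .lin) ∧ Kinding Δ C .comp := by
  generalize hT : Ty.arrow Y A C = T at h
  induction h with
  | arrow hA hC => cases hT; exact ⟨⟨_, rfl, .refl _⟩, hA.to_lin, hC⟩
  | upcast _ hs ih =>
    obtain ⟨⟨Y', rfl, hY⟩, h⟩ := ih hT
    cases hs with | type hs => exact ⟨⟨_, rfl, hY.trans hs⟩, h⟩
  | _ => cases hT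

theorem all_inv (h : Kinding Δ (.all Y K' C) K) :
    (∃ Y', K = .type Y' ∧ Lin.Le Y Y') ∧ Kinding (K' :: Δ) C .comp := by
  generalize hT : Ty.all Y K' C = T at h
  induction h with
  | all hC => cases hT; exact ⟨⟨_, rfl, .refl _⟩, hC⟩
  | upcast _ hs ih =>
    obtain ⟨⟨Y', rfl, hY⟩, h⟩ := ih hT
    cases hs with | type hs => exact ⟨⟨_, rfl, hY.trans hs⟩, h⟩
  | _ => cases hT

theorem comp_inv (h : Kinding Δ (.comp A E) K) :
    K = .comp ∧ Kinding Δ A (.type .lin) ∧ Kinding Δ E .effect := by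
  generalize hT : Ty.comp A E = T at h
  induction h with
  | comp hA hE => cases hT; exact ⟨rfl, hA.to_lin, hE⟩
  | upcast _ hs ih => obtain ⟨rfl, -⟩ := ih hT; cases hs
  | _ => cases hT

theorem eff_inv (h : Kinding Δ (.eff R) K) : K = .effect ∧ ∃ Y, Kinding Δ R (.row ∅ Y) := by
  generalize hT : Ty.eff R = T at h
  induction h with
  | eff hR => cases hT; exact ⟨rfl, _, hR⟩
  | upcast _ hs ih => obtain ⟨rfl, -⟩ := ih hT; cases hs
  | _ => cases hT

theorem op_inv (h : Kinding Δ (.op Y A B) K) :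
    (∃ Y', K = .pres Y' ∧ Lin.Le Y' Y) ∧ Kinding Δ A (.type .lin) ∧ Kinding Δ B (.type .lin) := by
  generalize hT : Ty.op Y A B = T at h
  induction h with
  | op hA hB => cases hT; exact ⟨⟨_, rfl, .refl _⟩, hA.to_lin, hB.to_lin⟩
  | upcast _ hs ih =>
    obtain ⟨⟨Y', rfl, hY⟩, h⟩ := ih hT
    cases hs with | pres hs => exact ⟨⟨_, rfl, hs.trans hY⟩, h⟩
  | _ => cases hT

theorem rowCons_inv {l : Label} (h : Kinding Δ (.rowCons l P R) K) :
    ∃ L Y, K = .row L Y ∧ l ∉ L ∧ Kinding Δ P (.pres Y) ∧ Kinding Δ R (.row (insert l L) Y) := by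
  generalize hT : Ty.rowCons l P R = T at h
  induction h with
  | rowCons hP hl hR => cases hT; exact ⟨_, _, rfl, hl, hP, hR⟩
  | upcast _ hs ih =>
    obtain ⟨L, Y, rfl, hl, hP, hR⟩ := ih hT
    cases hs with
    | row hs => exact ⟨_, _, rfl, hl, .upcast hP (.pres hs), .upcast hR (.row hs)⟩
  | _ => cases hT

theorem arrow_unl_iff (h : Kinding Δ (.arrow Y A C) K) :
    Kinding Δ (.arrow Y A C) (.type .unl) ↔ Y = .unl := by
  constructor
  · intro h'
    obtain ⟨⟨_, hK, hY⟩, -⟩ := h'.arrow_inv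
    cases hK
    exact hY.eq_unl
  · rintro rfl
    exact .arrow h.arrow_inv.2.1 h.arrow_inv.2.2

theorem all_unl_iff (h : Kinding Δ (.all Y K' C) K) :
    Kinding Δ (.all Y K' C) (.type .unl) ↔ Y = .unl := by
  constructor
  · intro h'
    obtain ⟨⟨_, hK, hY⟩, -⟩ := h'.all_inv
    cases hK
    exact hY.eq_unl
  · rintro rfl
    exact .all h.all_inv.2

end Kinding

/-! ### Entries of rows -/

namespace Ty

section RowMem

variable {Δ : KCtx} {l : Label} {P P' Q R : Ty} {L : Finset Label} {Y : Lin} {A B : Ty}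
  {sigs : List (Label × Lin × Ty × Ty)}

theorem RowMem.notMem (hm : RowMem l P R) (h : Kinding Δ R (.row L Y)) : l ∉ L := by
  induction hm generalizing L with
  | here =>
    obtain ⟨_, _, hK, hl, -⟩ := h.rowCons_inv
    cases hK; exact hl
  | there _ ih =>
    obtain ⟨_, _, hK, -, -, hR⟩ := h.rowCons_inv
    cases hK; exact fun hl => ih hR (Finset.mem_insert_of_mem hl)

theorem RowMem.kinding (hm : RowMem l P R) (h : Kinding Δ R (.row L Y)) :
    Kinding Δ P (.pres Y) := by
  induction hm generalizing L with
  | here =>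
    obtain ⟨_, _, hK, -, hP, -⟩ := h.rowCons_inv
    cases hK; exact hP
  | there _ ih =>
    obtain ⟨_, _, hK, -, -, hR⟩ := h.rowCons_inv
    cases hK; exact ih hR

theorem RowMem.unique (hm : RowMem l P R) (hm' : RowMem l P' R) (h : Kinding Δ R (.row L Y)) :
    P = P' := by
  induction hm generalizing L with
  | here =>
    obtain ⟨_, _, hK, -, -, hR⟩ := h.rowCons_inv
    cases hK
    cases hm' with
    | here => rfl
    | there hm' => exact absurd (Finset.mem_insert_self _ _) (hm'.notMem hR)
  | there hm ih =>
    obtain ⟨_, _, hK, -, -, hR⟩ := h.rowCons_inv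
    cases hK
    cases hm' with
    | here => exact absurd (Finset.mem_insert_self _ _) (hm.notMem hR)
    | there hm' => exact ih hm' hR

theorem rowMem_opsRow (h : (l, Y, A, B) ∈ sigs) : RowMem l (op Y A B) (opsRow sigs R) := by
  induction sigs with
  | nil => cases h
  | cons s sigs ih =>
    rcases List.mem_cons.1 h with rfl | h
    · exact .here
    · exact .there (ih h)

theorem RowMem.presRow_of_opsRow (h : RowMem l P (opsRow sigs R)) (hl : l ∉ sigs.map Prod.fst) :
    RowMem l P (presRow sigs Q R) := by
  induction sigs with
  | nil => exact h
  | cons s sigs ih =>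
    rw [List.map_cons, List.mem_cons, not_or] at hl
    cases h with
    | here => exact absurd rfl hl.1
    | there h => exact .there (ih h hl.2)

end RowMem

/-! ### Identification of types -/

/-- The type formers that `Eqv` respects literally. -/
def IsRigid : Ty → Prop
  | arrow _ _ _ | all _ _ _ | comp _ _ | eff _ | op _ _ _ => True
  | _ => False

/-- Equality of outermost type formers together with `Eqv` of their arguments.  Rows, where `Eqv`
moves and drops labels, are left unconstrained. -/
inductive HeadEqv : Ty → Ty → Prop
  | arrow {Y A A' C C'} : Eqv A A' → Eqv C C' → HeadEqv (arrow Y A C) (arrow Y A' C')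
  | all {Y K C C'} : Eqv C C' → HeadEqv (all Y K C) (all Y K C')
  | comp {A A' E E'} : Eqv A A' → Eqv E E' → HeadEqv (comp A E) (comp A' E')
  | eff {R R'} : Eqv R R' → HeadEqv (eff R) (eff R')
  | op {Y A A' B B'} : Eqv A A' → Eqv B B' → HeadEqv (op Y A B) (op Y A' B')
  | other {T U} : ¬ T.IsRigid → ¬ U.IsRigid → HeadEqv T U

namespace HeadEqv

theorem refl (T : Ty) : HeadEqv T T := by
  cases T with
  | arrow => exact .arrow (.refl _) (.refl _)
  | all => exact .all (.refl _)
  | comp => exact .comp (.refl _) (.refl _)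
  | eff => exact .eff (.refl _)
  | op => exact .op (.refl _) (.refl _)
  | _ => exact .other id id

theorem symm {T U : Ty} (h : HeadEqv T U) : HeadEqv U T := by
  cases h with
  | arrow hA hC => exact .arrow hA.symm hC.symm
  | all hC => exact .all hC.symm
  | comp hA hE => exact .comp hA.symm hE.symm
  | eff hR => exact .eff hR.symm
  | op hA hB => exact .op hA.symm hB.symm
  | other hT hU => exact .other hU hT

theorem trans {T U V : Ty} (h : HeadEqv T U) (h' : HeadEqv U V) : HeadEqv T V := by
  cases h with
  | other hT hU => cases h' with
    | other _ hV => exact .other hT hV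
    | _ => exact absurd trivial hU
  | arrow hA hC => cases h' with
    | arrow hA' hC' => exact .arrow (hA.trans hA') (hC.trans hC')
    | other h _ => exact absurd trivial h
  | all hC => cases h' with
    | all hC' => exact .all (hC.trans hC')
    | other h _ => exact absurd trivial h
  | comp hA hE => cases h' with
    | comp hA' hE' => exact .comp (hA.trans hA') (hE.trans hE')
    | other h _ => exact absurd trivial h
  | eff hR => cases h' with
    | eff hR' => exact .eff (hR.trans hR')
    | other h _ => exact absurd trivial h
  | op hA hB => cases h' with
    | op hA' hB' => exact .op (hA.trans hA') (hB.trans hB')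
    | other h _ => exact absurd trivial h

end HeadEqv

theorem IsClosedRow.not_isRigid {R : Ty} (h : IsClosedRow R) : ¬ R.IsRigid := by
  cases h <;> exact id

namespace Eqv

variable {Y : Lin} {K : Kind} {A A' B C E R R' T U : Ty}

theorem headEqv (h : Eqv T U) : HeadEqv T U := by
  induction h with
  | refl T => exact .refl T
  | symm _ ih => exact ih.symm
  | trans _ _ ih₁ ih₂ => exact ih₁.trans ih₂
  | arrow hA hC => exact .arrow hA hC
  | all hC => exact .all hC
  | comp hA hE => exact .comp hA hE
  | eff hR => exact .eff hR
  | op hA hB => exact .op hA hB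
  | absent hR => exact .other id hR.not_isRigid
  | _ => exact .other id id

theorem arrow_inv (h : Eqv (.arrow Y A C) U) :
    ∃ A' C', U = .arrow Y A' C' ∧ Eqv A A' ∧ Eqv C C' := by
  cases h.headEqv with
  | arrow hA hC => exact ⟨_, _, rfl, hA, hC⟩
  | other h _ => exact absurd trivial h

theorem all_inv (h : Eqv (.all Y K C) U) : ∃ C', U = .all Y K C' ∧ Eqv C C' := by
  cases h.headEqv with
  | all hC => exact ⟨_, rfl, hC⟩
  | other h _ => exact absurd trivial h

theorem comp_inv (h : Eqv (.comp A E) U) : ∃ A' E', U = .comp A' E' ∧ Eqv A A' ∧ Eqv E E' := by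
  cases h.headEqv with
  | comp hA hE => exact ⟨_, _, rfl, hA, hE⟩
  | other h _ => exact absurd trivial h

theorem eff_inv (h : Eqv (.eff R) U) : ∃ R', U = .eff R' ∧ Eqv R R' := by
  cases h.headEqv with
  | eff hR => exact ⟨_, rfl, hR⟩
  | other h _ => exact absurd trivial h

theorem row_of_comp (h : Eqv (.comp A (.eff R)) (.comp A' (.eff R'))) :
    Eqv R R' := by
  obtain ⟨_, _, hT, -, e⟩ := h.comp_inv
  cases hT
  obtain ⟨_, hT, e⟩ := e.eff_inv
  cases hT
  exact e

theorem op_inv (h : Eqv (.op Y A B) U) : ∃ A' B', U = .op Y A' B' ∧ Eqv A A' ∧ Eqv B B' := by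
  cases h.headEqv with
  | op hA hB => exact ⟨_, _, rfl, hA, hB⟩
  | other h _ => exact absurd trivial h

end Eqv

/-- The row `R` contains `l : A ↠^Y B`, up to identification of types. -/
def RowHasOp (R : Ty) (l : Label) (Y : Lin) (A B : Ty) : Prop :=
  ∃ P, RowMem l P R ∧ Eqv P (op Y A B)

section RowHasOp

variable {l l' : Label} {Y Y' : Lin} {A A' B B' P R R' : Ty}

theorem rowHasOp_rowCons :
    (rowCons l' P R).RowHasOp l Y A B ↔ l = l' ∧ Eqv P (op Y A B) ∨ R.RowHasOp l Y A B := by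
  constructor
  · rintro ⟨_, _ | hm, e⟩
    · exact .inl ⟨rfl, e⟩
    · exact .inr ⟨_, hm, e⟩
  · rintro (⟨rfl, e⟩ | ⟨_, hm, e⟩)
    · exact ⟨_, .here, e⟩
    · exact ⟨_, .there hm, e⟩

theorem Eqv.rowHasOp_iff (h : Eqv R R') : R.RowHasOp l Y A B ↔ R'.RowHasOp l Y A B := by
  induction h with
  | refl => exact Iff.rfl
  | symm _ ih => exact ih.symm
  | trans _ _ ih₁ ih₂ => exact ih₁.trans ih₂
  | rowCons hP _ _ ih =>
    rw [rowHasOp_rowCons, rowHasOp_rowCons, ih]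
    exact or_congr_left (and_congr_right fun _ => ⟨hP.symm.trans, hP.trans⟩)
  | swap => simp only [rowHasOp_rowCons]; exact or_left_comm
  | absent =>
    rw [rowHasOp_rowCons, or_iff_right]
    rintro ⟨-, e⟩
    obtain ⟨_, _, hAbs, -⟩ := e.symm.op_inv
    cases hAbs
  | _ => constructor <;> rintro ⟨_, ⟨⟩, -⟩

theorem RowHasOp.unique (h : R.RowHasOp l Y A B) (h' : R.RowHasOp l Y' A' B') {Δ : KCtx}
    {L : Finset Label} {X : Lin} (hR : Kinding Δ R (.row L X)) : Y = Y' ∧ Eqv A A' ∧ Eqv B B' := by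
  obtain ⟨P, hm, e⟩ := h
  obtain ⟨P', hm', e'⟩ := h'
  cases hm.unique hm' hR
  obtain ⟨_, _, hop, hA, hB⟩ := (e.symm.trans e').op_inv
  cases hop
  exact ⟨rfl, hA, hB⟩

theorem RowHasOp.le (h : R.RowHasOp l Y A B) {Δ : KCtx} {L : Finset Label} {X : Lin}
    (hR : Kinding Δ R (.row L X)) : Lin.Le X Y := by
  obtain ⟨P, hm, e⟩ := h
  obtain ⟨_, _, rfl, -⟩ := e.symm.op_inv
  obtain ⟨⟨_, hK, hle⟩, -⟩ := (hm.kinding hR).op_inv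
  cases hK
  exact hle

end RowHasOp

end Ty

/-! ### Renaming and substitution in types -/

namespace Ty

section Subst

variable (T : Ty) (ξ ζ : ℕ → ℕ) (σ τ : ℕ → Ty)

theorem upSubst_var : upSubst var = var := by
  funext n; cases n <;> rfl

theorem subst_var : T.subst var = T := by
  induction T <;> simp_all [subst, upSubst_var]

theorem rename_eq_subst : T.rename ξ = T.subst (fun n => var (ξ n)) := by
  induction T generalizing ξ with
  | all Y K C ih =>
    simp only [rename, subst, ih]
    congr 2; funext n; cases n <;> rfl
  | _ => simp_all [rename, subst]

theorem subst_rename : (T.rename ξ).subst σ = T.subst (fun n => σ (ξ n)) := by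
  induction T generalizing ξ σ with
  | all Y K C ih =>
    simp only [rename, subst, ih]
    congr 2; funext n; cases n <;> rfl
  | _ => simp_all [rename, subst]

theorem rename_id : T.rename id = T := by
  rw [rename_eq_subst]
  exact T.subst_var

theorem rename_rename : (T.rename ξ).rename ζ = T.rename (fun n => ζ (ξ n)) := by
  rw [rename_eq_subst (T.rename ξ), subst_rename, rename_eq_subst]

theorem rename_subst : (T.subst σ).rename ξ = T.subst (fun n => (σ n).rename ξ) := by
  induction T generalizing ξ σ with
  | all Y K C ih =>
    simp only [rename, subst, ih]
    congr 2; funext n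
    cases n with
    | zero => rfl
    | succ n => simp only [upSubst, rename_rename]; rfl
  | _ => simp_all [rename, subst]

theorem subst_subst : (T.subst σ).subst τ = T.subst (fun n => (σ n).subst τ) := by
  induction T generalizing σ τ with
  | all Y K C ih =>
    simp only [subst, ih]
    congr 2; funext n
    cases n with
    | zero => rfl
    | succ n => simp only [upSubst, subst_rename, rename_subst]
  | _ => simp_all [subst]

theorem subst_upSubst_shift :
    (T.rename Nat.succ).subst (upSubst τ) = (T.subst τ).rename Nat.succ := by
  rw [subst_rename, rename_subst]; rfl

theorem inst_subst (C : Ty) :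
    (C.inst T).subst τ = (C.subst (upSubst τ)).inst (T.subst τ) := by
  simp only [inst, subst_subst]
  congr 1; funext n
  cases n with
  | zero => rfl
  | succ n =>
    simp only [upSubst, subst_rename]
    exact (subst_var _).symm

end Subst

theorem IsClosedRow.subst {R : Ty} (h : IsClosedRow R) (τ : ℕ → Ty) : IsClosedRow (R.subst τ) := by
  induction h with
  | nil => exact .nil
  | cons _ ih => exact .cons ih

theorem Eqv.subst {T U : Ty} (h : Eqv T U) (τ : ℕ → Ty) : Eqv (T.subst τ) (U.subst τ) := by
  induction h generalizing τ with
  | refl => exact .refl _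
  | symm _ ih => exact (ih τ).symm
  | trans _ _ ih₁ ih₂ => exact (ih₁ τ).trans (ih₂ τ)
  | arrow _ _ ih₁ ih₂ => exact .arrow (ih₁ τ) (ih₂ τ)
  | all _ ih => exact .all (ih _)
  | comp _ _ ih₁ ih₂ => exact .comp (ih₁ τ) (ih₂ τ)
  | eff _ ih => exact .eff (ih τ)
  | rowCons _ _ ih₁ ih₂ => exact .rowCons (ih₁ τ) (ih₂ τ)
  | op _ _ ih₁ ih₂ => exact .op (ih₁ τ) (ih₂ τ)
  | handler _ _ ih₁ ih₂ => exact .handler (ih₁ τ) (ih₂ τ)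
  | swap h => exact .swap h
  | absent h => exact .absent (h.subst τ)

/-- Type substitution in the operation signatures of a handler. -/
def substSigs (τ : ℕ → Ty) (sigs : List (Label × Lin × Ty × Ty)) : List (Label × Lin × Ty × Ty) :=
  sigs.map fun s => (s.1, s.2.1, s.2.2.1.subst τ, s.2.2.2.subst τ)

theorem subst_opsRow (τ : ℕ → Ty) (sigs : List (Label × Lin × Ty × Ty)) (R : Ty) :
    (opsRow sigs R).subst τ = opsRow (substSigs τ sigs) (R.subst τ) := by
  induction sigs with
  | nil => rfl
  | cons s sigs ih => simp only [opsRow, subst, ih]; rfl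

theorem subst_presRow (τ : ℕ → Ty) (sigs : List (Label × Lin × Ty × Ty)) (P R : Ty) :
    (presRow sigs P R).subst τ = presRow (substSigs τ sigs) (P.subst τ) (R.subst τ) := by
  induction sigs with
  | nil => rfl
  | cons s sigs ih => simp only [presRow, subst, ih]; rfl

end Ty

namespace Kinding

variable {Δ Δ' : KCtx} {C T : Ty} {K K' : Kind} {ξ : ℕ → ℕ} {τ : ℕ → Ty}

theorem rename (h : Kinding Δ T K)
    (hξ : ∀ n K, Δ[n]? = some K → Δ'[ξ n]? = some K) : Kinding Δ' (T.rename ξ) K := by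
  induction h generalizing Δ' ξ with
  | var hn hK => exact .var (hξ _ _ hn) hK
  | all _ ih =>
    refine .all (ih ?_)
    rintro (_ | n) K h
    · exact h
    · exact hξ n K h
  | arrow _ _ ih₁ ih₂ => exact .arrow (ih₁ hξ) (ih₂ hξ)
  | comp _ _ ih₁ ih₂ => exact .comp (ih₁ hξ) (ih₂ hξ)
  | eff _ ih => exact .eff (ih hξ)
  | op _ _ ih₁ ih₂ => exact .op (ih₁ hξ) (ih₂ hξ)
  | abs => exact .abs
  | rowNil => exact .rowNil
  | rowCons _ hl _ ih₁ ih₂ => exact .rowCons (ih₁ hξ) hl (ih₂ hξ)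
  | handler _ _ ih₁ ih₂ => exact .handler (ih₁ hξ) (ih₂ hξ)
  | upcast _ hs ih => exact .upcast (ih hξ) hs

theorem shift (h : Kinding Δ T K) (K' : Kind) : Kinding (K' :: Δ) (T.rename Nat.succ) K :=
  h.rename fun _ _ h => h

/-- Well-kinded type substitutions: `τ` maps the variables of `Δ` to types of the same kind over
`Δ'`. -/
def Subst (Δ Δ' : KCtx) (τ : ℕ → Ty) : Prop :=
  ∀ n K, Δ[n]? = some K → K.HasVars → Kinding Δ' (τ n) K

theorem Subst.var : Subst Δ Δ Ty.var := fun _ _ hn hK => .var hn hK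

theorem Subst.up (h : Subst Δ Δ' τ) (K : Kind) :
    Subst (K :: Δ) (K :: Δ') (Ty.upSubst τ) := by
  rintro (_ | n) K' hn hK
  · exact .var hn hK
  · exact (h n K' hn hK).shift K

theorem Subst.single (h : Kinding Δ T K) : Subst (K :: Δ) Δ (Ty.single T) := by
  rintro (_ | n) K' hn hK
  · cases hn; exact h
  · exact .var hn hK

theorem subst (h : Kinding Δ T K) (hτ : Subst Δ Δ' τ) : Kinding Δ' (T.subst τ) K := by
  induction h generalizing Δ' τ with
  | var hn hK => exact hτ _ _ hn hK
  | all _ ih => exact .all (ih (hτ.up _))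
  | arrow _ _ ih₁ ih₂ => exact .arrow (ih₁ hτ) (ih₂ hτ)
  | comp _ _ ih₁ ih₂ => exact .comp (ih₁ hτ) (ih₂ hτ)
  | eff _ ih => exact .eff (ih hτ)
  | op _ _ ih₁ ih₂ => exact .op (ih₁ hτ) (ih₂ hτ)
  | abs => exact .abs
  | rowNil => exact .rowNil
  | rowCons _ hl _ ih₁ ih₂ => exact .rowCons (ih₁ hτ) hl (ih₂ hτ)
  | handler _ _ ih₁ ih₂ => exact .handler (ih₁ hτ) (ih₂ hτ)
  | upcast _ hs ih => exact .upcast (ih hτ) hs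

theorem inst (hC : Kinding (K :: Δ) C K') (hT : Kinding Δ T K) : Kinding Δ (C.inst T) K' :=
  hC.subst (.single hT)

theorem append (h : Kinding Δ T K) (Δ' : KCtx) : Kinding (Δ ++ Δ') T K := by
  rw [← T.rename_id]
  exact h.rename fun n K hn => by
    rw [id, List.getElem?_append_left (List.getElem?_eq_some_iff.1 hn).1, hn]

theorem subst_eq (h : Kinding Δ T K) (hτ : ∀ n < Δ.length, τ n = .var n) : T.subst τ = T := by
  induction h generalizing τ with
  | var hn => exact hτ _ (List.getElem?_eq_some_iff.1 hn).1
  | all _ ih =>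
    refine congrArg _ (ih ?_)
    rintro (_ | n) hn
    · rfl
    · rw [Ty.upSubst, hτ n (Nat.lt_of_succ_lt_succ hn)]; rfl
  | _ => simp_all [Ty.subst]

theorem rename_eq (h : Kinding Δ T K) (hξ : ∀ n < Δ.length, ξ n = n) : T.rename ξ = T := by
  rw [Ty.rename_eq_subst]
  exact h.subst_eq fun n hn => congrArg _ (hξ n hn)

end Kinding

/-! ### Contexts -/

/-- Substitution of types in all entries of a context, the context transformation under which typing
is stable when types are substituted in a term. -/
def Ctx.tsubst (τ : ℕ → Ty) (Γ : Ctx) : Ctx := Γ.map (Option.map (Ty.subst τ))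

theorem Ctx.tsubst_tshift (τ : ℕ → Ty) (Γ : Ctx) :
    Ctx.tsubst (Ty.upSubst τ) (Ctx.tshift Γ) = Ctx.tshift (Ctx.tsubst τ Γ) := by
  simp only [Ctx.tsubst, Ctx.tshift, List.map_map]
  congr 1
  funext A
  cases A with
  | none => rfl
  | some A => exact congrArg some (A.subst_upSubst_shift τ)

theorem Ctx.tshift_take (Γ : Ctx) (k : ℕ) :
    Ctx.tshift (Γ.take k) = (Ctx.tshift Γ).take k := List.map_take

namespace CtxLin

variable {Δ Δ' : KCtx} {Γ Γ' : Ctx} {Y : Lin}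

theorem append (h : CtxLin Δ Γ Y)
    (h' : CtxLin (Δ ++ Δ') Γ' .unl) : CtxLin (Δ ++ Δ') (Γ ++ Γ') Y := by
  intro A hA
  rcases List.mem_append.1 hA with hA | hA
  · exact (h A hA).append Δ'
  · exact (h' A hA).of_unl Y

theorem tshift (h : CtxLin Δ Γ Y) (K : Kind) :
    CtxLin (K :: Δ) (Ctx.tshift Γ) Y := by
  intro A hA
  obtain ⟨B, hB, hBA⟩ := List.mem_map.1 hA
  cases B with
  | none => cases hBA
  | some B => cases hBA; exact (h B hB).shift K

theorem take (h : CtxLin Δ Γ Y) (k : ℕ) : CtxLin Δ (Γ.take k) Y :=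
  fun A hA => h A (List.mem_of_mem_take hA)

theorem nil : CtxLin Δ [] Y := fun _ h => nomatch h

theorem subst {τ : ℕ → Ty} (h : CtxLin Δ Γ Y) (hτ : Kinding.Subst Δ Δ' τ) :
    CtxLin Δ' (Ctx.tsubst τ Γ) Y := by
  intro A hA
  obtain ⟨B, hB, hBA⟩ := List.mem_map.1 hA
  cases B with
  | none => cases hBA
  | some B => cases hBA; exact (h B hB).subst hτ

end CtxLin

namespace Split

variable {Δ Δ' : KCtx} {Γ Γ₁ Γ₂ Γ' : Ctx} {n : ℕ} {A : Ty}

theorem self (h : CtxLin Δ Γ .unl) : Split Δ Γ Γ Γ := by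
  induction Γ with
  | nil => exact .nil
  | cons A Γ ih =>
    have ih := ih fun B hB => h B (List.mem_cons_of_mem _ hB)
    cases A with
    | none => exact .none ih
    | some A => exact .unl (h A List.mem_cons_self) ih

theorem append (h : Split Δ Γ Γ₁ Γ₂) (h' : CtxLin (Δ ++ Δ') Γ' .unl) :
    Split (Δ ++ Δ') (Γ ++ Γ') (Γ₁ ++ Γ') (Γ₂ ++ Γ') := by
  induction h with
  | nil => exact self h'
  | none _ ih => exact .none ih
  | unl hA _ ih => exact .unl (hA.append Δ') ih
  | linLeft hA _ ih => exact .linLeft (hA.append Δ') ih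
  | linRight hA _ ih => exact .linRight (hA.append Δ') ih

theorem take (h : Split Δ Γ Γ₁ Γ₂) (k : ℕ) :
    Split Δ (Γ.take k) (Γ₁.take k) (Γ₂.take k) := by
  induction h generalizing k with
  | nil => simpa using Split.nil
  | none _ ih => cases k with
    | zero => exact .nil
    | succ k => exact .none (ih k)
  | unl hA _ ih => cases k with
    | zero => exact .nil
    | succ k => exact .unl hA (ih k)
  | linLeft hA _ ih => cases k with
    | zero => exact .nil
    | succ k => exact .linLeft hA (ih k)
  | linRight hA _ ih => cases k with
    | zero => exact .nil
    | succ k => exact .linRight hA (ih k)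

theorem length (h : Split Δ Γ Γ₁ Γ₂) : Γ₁.length = Γ.length ∧ Γ₂.length = Γ.length := by
  induction h <;> simp_all

theorem get_left (h : Split Δ Γ Γ₁ Γ₂) (hA : Γ₁[n]? = some (some A)) :
    Γ[n]? = some (some A) := by
  induction h generalizing n with
  | nil => exact hA
  | _ => cases n <;> simp_all

theorem get_right (h : Split Δ Γ Γ₁ Γ₂) (hA : Γ₂[n]? = some (some A)) :
    Γ[n]? = some (some A) := by
  induction h generalizing n with
  | nil => exact hA
  | _ => cases n <;> simp_all

theorem subst {τ : ℕ → Ty} (h : Split Δ Γ Γ₁ Γ₂) (hτ : Kinding.Subst Δ Δ' τ) :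
    Split Δ' (Ctx.tsubst τ Γ) (Ctx.tsubst τ Γ₁) (Ctx.tsubst τ Γ₂) := by
  induction h with
  | nil => exact .nil
  | none _ ih => exact .none ih
  | unl hA _ ih => exact .unl (hA.subst hτ) ih
  | linLeft hA _ ih => exact .linLeft (hA.subst hτ) ih
  | linRight hA _ ih => exact .linRight (hA.subst hτ) ih

theorem nil_inv (h : Split Δ [] Γ₁ Γ₂) : Γ₁ = [] ∧ Γ₂ = [] := by
  cases h; exact ⟨rfl, rfl⟩

end Split

/-! ### Regularity and generation -/

theorem HndTy.kinding {Δ : KCtx} {Γ : Ctx} {H : Hnd} {C D : Ty} :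
    HndTy Δ Γ H C D → Kinding Δ D .comp
  | .handler _ _ h _ => h

mutual
theorem ValTy.kinding {Δ : KCtx} {Γ : Ctx} {V : Val} {A : Ty} :
    ValTy Δ Γ V A → Kinding Δ A (.type .lin)
  | .var _ h _ => h
  | .lam _ h h' => (Kinding.arrow h h'.kinding).to_lin
  | .tlam _ h => (Kinding.all h.kinding).to_lin
  | .tag h => h.kinding
  | .conv _ _ h => h.to_lin
theorem CompTy.kinding {Δ : KCtx} {Γ : Ctx} {M : Comp} {C : Ty} :
    CompTy Δ Γ M C → Kinding Δ C .comp
  | .app _ h _ => h.kinding.arrow_inv.2.2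
  | .tapp h hT => h.kinding.all_inv.2.inst hT
  | .ret h hE => .comp h.kinding hE
  | .perform _ h hE _ => by
    obtain ⟨-, _, h⟩ := h.eff_inv
    obtain ⟨_, _, -, -, h, -⟩ := h.rowCons_inv
    exact .comp h.op_inv.2.2 hE
  | .bind _ _ h _ _ => h.kinding
  | .handle _ h _ => h.kinding
  | .conv _ _ h => h
end

/-- `ValTy.Rule Δ Γ V A`: some typing rule other than conversion concludes `Δ; Γ ⊢ V : A`.  Unlike
`ValTy`, it admits at most one rule for each shape of `V`. -/
inductive ValTy.Rule (Δ : KCtx) (Γ : Ctx) : Val → Ty → Prop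
  | var {n A} : Γ[n]? = some (some A) → ValTy.Rule Δ Γ (.var n) A
  | lam {Y A M C} : CtxLin Δ Γ Y → Kinding Δ A (.type .lin) → CompTy Δ (some A :: Γ) M C →
      ValTy.Rule Δ Γ (.lam Y A M) (.arrow Y A C)
  | tlam {Y K M C} : CtxLin Δ Γ Y → CompTy (K :: Δ) (Ctx.tshift Γ) M C →
      ValTy.Rule Δ Γ (.tlam Y K M) (.all Y K C)
  | tag {V A} : ValTy Δ Γ V A → ValTy.Rule Δ Γ (.tag V) A

theorem ValTy.generation {Δ : KCtx} {Γ : Ctx} {V : Val} {B : Ty} :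
    ValTy Δ Γ V B → ∃ A, ValTy.Rule Δ Γ V A ∧ Ty.Eqv A B
  | .var h _ _ => ⟨_, .var h, .refl _⟩
  | .lam h hA hM => ⟨_, .lam h hA.to_lin hM, .refl _⟩
  | .tlam h hM => ⟨_, .tlam h hM, .refl _⟩
  | .tag h => ⟨_, .tag h, .refl _⟩
  | .conv h e _ =>
    let ⟨_, r, e'⟩ := h.generation
    ⟨_, r, e'.trans e⟩

theorem ValTy.tag_inv {Δ : KCtx} {Γ : Ctx} {V : Val} {A : Ty} (h : ValTy Δ Γ (.tag V) A) :
    ValTy Δ Γ V A := by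
  obtain ⟨_, hV, e⟩ := h.generation
  cases hV with | tag hV => exact .conv hV e h.kinding

/-- `CompTy.Rule Δ Γ M C`: some typing rule other than conversion concludes `Δ; Γ ⊢ M : C`.  Unlike
`CompTy`, it admits at most one rule for each shape of `M`. -/
inductive CompTy.Rule (Δ : KCtx) (Γ : Ctx) : Comp → Ty → Prop
  | app {Γ₁ Γ₂ V W Y A C} : Split Δ Γ Γ₁ Γ₂ → ValTy Δ Γ₁ V (.arrow Y A C) → ValTy Δ Γ₂ W A →
      CompTy.Rule Δ Γ (.app V W) C
  | tapp {V Y K C T} : ValTy Δ Γ V (.all Y K C) → Kinding Δ T K →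
      CompTy.Rule Δ Γ (.tapp V T) (C.inst T)
  | ret {V A E} : ValTy Δ Γ V A → Kinding Δ E .effect → CompTy.Rule Δ Γ (.ret V E) (.comp A E)
  | perform {l V Y A B R E} : Ty.Eqv E (.eff (.rowCons l (.op Y A B) R)) →
      Kinding Δ (.eff (.rowCons l (.op Y A B) R)) .effect → Kinding Δ E .effect →
      ValTy Δ Γ V A → CompTy.Rule Δ Γ (.perform l V E) (.comp B E)
  | bind {Γ₁ Γ₂ Y M N A B R} : Split Δ Γ Γ₁ Γ₂ → CompTy Δ Γ₁ M (.comp A (.eff R)) →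
      CompTy Δ (some A :: Γ₂) N (.comp B (.eff R)) → CtxLin Δ Γ₂ Y → Kinding Δ R (.row ∅ Y) →
      CompTy.Rule Δ Γ (.bind Y M N) (.comp B (.eff R))
  | handle {Γ₁ Γ₂ M H C D} : Split Δ Γ Γ₁ Γ₂ → HndTy Δ Γ₁ H C D → CompTy Δ Γ₂ M C →
      CompTy.Rule Δ Γ (.handle M H) D

theorem CompTy.generation {Δ : KCtx} {Γ : Ctx} {M : Comp} {D : Ty} :
    CompTy Δ Γ M D → ∃ C, CompTy.Rule Δ Γ M C ∧ Ty.Eqv C D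
  | .app hs hV hW => ⟨_, .app hs hV hW, .refl _⟩
  | .tapp hV hT => ⟨_, .tapp hV hT, .refl _⟩
  | .ret hV hE => ⟨_, .ret hV hE, .refl _⟩
  | .perform e hR hE hV => ⟨_, .perform e hR hE hV, .refl _⟩
  | .bind hs hM hN h hR => ⟨_, .bind hs hM hN h hR, .refl _⟩
  | .handle hs hH hM => ⟨_, .handle hs hH hM, .refl _⟩
  | .conv h e _ =>
    let ⟨_, r, e'⟩ := h.generation
    ⟨_, r, e'.trans e⟩

/-! ### Weakening -/

mutual
theorem ValTy.append {Δ : KCtx} {Γ : Ctx} {V : Val} {A : Ty} :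
    ValTy Δ Γ V A → ∀ {Δ' : KCtx} {Γ' : Ctx}, CtxLin (Δ ++ Δ') Γ' .unl →
      ValTy (Δ ++ Δ') (Γ ++ Γ') V A
  | .var hn hA h, Δ', Γ', h' => by
    refine .var ?_ (hA.append Δ') ?_
    · rw [List.getElem?_append_left (List.getElem?_eq_some_iff.1 hn).1, hn]
    · intro m B hm hB
      rcases lt_or_ge m Γ.length with hlt | hge
      · rw [List.getElem?_append_left hlt] at hB
        exact (h m B hm hB).append Δ'
      · rw [List.getElem?_append_right hge] at hB
        exact h' B (List.mem_of_getElem? hB)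
  | .lam h hA hM, Δ', _, h' => .lam (h.append h') (hA.append Δ') (hM.append h')
  | .tlam h hM, Δ', Γ', h' => by
    refine .tlam (h.append h') ?_
    have := hM.append (h'.tshift _)
    simpa [Ctx.tshift] using this
  | .tag h, _, _, h' => .tag (h.append h')
  | .conv h e hB, Δ', _, h' => .conv (h.append h') e (hB.append Δ')
theorem CompTy.append {Δ : KCtx} {Γ : Ctx} {M : Comp} {C : Ty} :
    CompTy Δ Γ M C → ∀ {Δ' : KCtx} {Γ' : Ctx}, CtxLin (Δ ++ Δ') Γ' .unl →
      CompTy (Δ ++ Δ') (Γ ++ Γ') M C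
  | .app hs hV hW, _, _, h' => .app (hs.append h') (hV.append h') (hW.append h')
  | .tapp hV hT, Δ', _, h' => .tapp (hV.append h') (hT.append Δ')
  | .ret hV hE, Δ', _, h' => .ret (hV.append h') (hE.append Δ')
  | .perform e h hE hV, Δ', _, h' => .perform e (h.append Δ') (hE.append Δ') (hV.append h')
  | .bind hs hM hN h hR, Δ', _, h' =>
    .bind (hs.append h') (hM.append h') (hN.append h') (h.append h') (hR.append Δ')
  | .handle hs hH hM, _, _, h' => .handle (hs.append h') (hH.append h') (hM.append h')
  | .conv h e hD, Δ', _, h' => .conv (h.append h') e (hD.append Δ')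
theorem HndTy.append {Δ : KCtx} {Γ : Ctx} {H : Hnd} {C D : Ty} :
    HndTy Δ Γ H C D → ∀ {Δ' : KCtx} {Γ' : Ctx}, CtxLin (Δ ++ Δ') Γ' .unl →
      HndTy (Δ ++ Δ') (Γ ++ Γ') H C D
  | .handler h hC hD hH, Δ', _, h' =>
    .handler (h.append h') (hC.append Δ') (hD.append Δ') (hH.append h')
theorem ClausesTy.append {Δ : KCtx} {Γ : Ctx} {H : Hnd} {A : Ty}
    {sigs : List (Label × Lin × Ty × Ty)} {D : Ty} :
    ClausesTy Δ Γ H A sigs D → ∀ {Δ' : KCtx} {Γ' : Ctx}, CtxLin (Δ ++ Δ') Γ' .unl →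
      ClausesTy (Δ ++ Δ') (Γ ++ Γ') H A sigs D
  | .ret h, _, _, h' => .ret (h.append h')
  | .op h hH, _, _, h' => .op (h.append h') (hH.append h')
end

theorem upVal_eq_var {σ : ℕ → Val} {k : ℕ} (h : ∀ n < k, σ n = .var n) :
    ∀ n < k + 1, upVal σ n = .var n := by
  rintro (_ | n) hn
  · rfl
  · rw [upVal, h n (Nat.lt_of_succ_lt_succ hn)]; rfl

theorem tupVal_eq_var {σ : ℕ → Val} {k : ℕ} (h : ∀ n < k, σ n = .var n) :
    ∀ n < k, tupVal σ n = .var n := by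
  intro n hn
  rw [tupVal, h n hn]; rfl

theorem upSubst_eq_var {τ : ℕ → Ty} {k : ℕ} (h : ∀ n < k, τ n = .var n) :
    ∀ n < k + 1, Ty.upSubst τ n = .var n := by
  rintro (_ | n) hn
  · rfl
  · rw [Ty.upSubst, h n (Nat.lt_of_succ_lt_succ hn)]; rfl

mutual
theorem ValTy.subst_eq {Δ : KCtx} {Γ : Ctx} {V : Val} {A : Ty} :
    ValTy Δ Γ V A → ∀ {τ : ℕ → Ty} {σ : ℕ → Val}, (∀ n < Δ.length, τ n = .var n) →
      (∀ n < Γ.length, σ n = .var n) → V.subst τ σ = V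
  | .var hn _ _, _, _, _, hσ => hσ _ (List.getElem?_eq_some_iff.1 hn).1
  | .lam _ hA hM, _, _, hτ, hσ => by
    rw [Val.subst, hA.subst_eq hτ, hM.subst_eq hτ (upVal_eq_var hσ)]
  | .tlam _ hM, _, _, hτ, hσ => by
    rw [Val.subst, hM.subst_eq (upSubst_eq_var hτ)
      (tupVal_eq_var (by simpa [Ctx.tshift] using hσ))]
  | .tag h, _, _, hτ, hσ => by rw [Val.subst, h.subst_eq hτ hσ]
  | .conv h _ _, _, _, hτ, hσ => h.subst_eq hτ hσ
theorem CompTy.subst_eq {Δ : KCtx} {Γ : Ctx} {M : Comp} {C : Ty} :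
    CompTy Δ Γ M C → ∀ {τ : ℕ → Ty} {σ : ℕ → Val}, (∀ n < Δ.length, τ n = .var n) →
      (∀ n < Γ.length, σ n = .var n) → M.subst τ σ = M
  | .app hs hV hW, _, _, hτ, hσ => by
    rw [Comp.subst, hV.subst_eq hτ (hs.length.1 ▸ hσ), hW.subst_eq hτ (hs.length.2 ▸ hσ)]
  | .tapp hV hT, _, _, hτ, hσ => by rw [Comp.subst, hV.subst_eq hτ hσ, hT.subst_eq hτ]
  | .ret hV hE, _, _, hτ, hσ => by rw [Comp.subst, hV.subst_eq hτ hσ, hE.subst_eq hτ]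
  | .perform _ _ hE hV, _, _, hτ, hσ => by rw [Comp.subst, hV.subst_eq hτ hσ, hE.subst_eq hτ]
  | .bind hs hM hN _ _, _, _, hτ, hσ => by
    rw [Comp.subst, hM.subst_eq hτ (hs.length.1 ▸ hσ),
      hN.subst_eq hτ (upVal_eq_var (hs.length.2 ▸ hσ))]
  | .handle hs hH hM, _, _, hτ, hσ => by
    rw [Comp.subst, hM.subst_eq hτ (hs.length.2 ▸ hσ), hH.subst_eq hτ (hs.length.1 ▸ hσ)]
  | .conv h _ _, _, _, hτ, hσ => h.subst_eq hτ hσ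
theorem HndTy.subst_eq {Δ : KCtx} {Γ : Ctx} {H : Hnd} {C D : Ty} :
    HndTy Δ Γ H C D → ∀ {τ : ℕ → Ty} {σ : ℕ → Val}, (∀ n < Δ.length, τ n = .var n) →
      (∀ n < Γ.length, σ n = .var n) → H.subst τ σ = H
  | .handler _ _ _ hH, _, _, hτ, hσ => hH.subst_eq hτ hσ
theorem ClausesTy.subst_eq {Δ : KCtx} {Γ : Ctx} {H : Hnd} {A : Ty}
    {sigs : List (Label × Lin × Ty × Ty)} {D : Ty} :
    ClausesTy Δ Γ H A sigs D → ∀ {τ : ℕ → Ty} {σ : ℕ → Val}, (∀ n < Δ.length, τ n = .var n) →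
      (∀ n < Γ.length, σ n = .var n) → H.subst τ σ = H
  | .ret h, _, _, hτ, hσ => by rw [Hnd.subst, h.subst_eq hτ (upVal_eq_var hσ)]
  | .op h hH, _, _, hτ, hσ => by
    rw [Hnd.subst, h.subst_eq hτ (upVal_eq_var (upVal_eq_var hσ)), hH.subst_eq hτ hσ]
end

theorem upVal_var_comp (ξ : ℕ → ℕ) :
    upVal (fun n => .var (ξ n)) = fun n => Val.var (upRen ξ n) := by
  funext n; cases n <;> rfl

theorem upSubst_var_comp (ξ : ℕ → ℕ) :
    Ty.upSubst (fun n => .var (ξ n)) = fun n => Ty.var (upRen ξ n) := by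
  funext n; cases n <;> rfl

theorem tupVal_var_comp (ξ : ℕ → ℕ) :
    tupVal (fun n => .var (ξ n)) = fun n => Val.var (ξ n) := rfl

mutual
theorem Val.rename_eq_subst (ζ ξ : ℕ → ℕ) : ∀ V : Val,
    V.rename ζ ξ = V.subst (fun n => .var (ζ n)) (fun n => .var (ξ n))
  | .var n => rfl
  | .lam Y A M => by
    rw [Val.rename, Val.subst, Comp.rename_eq_subst, Ty.rename_eq_subst, upVal_var_comp]
  | .tlam Y K M => by
    rw [Val.rename, Val.subst, Comp.rename_eq_subst, upSubst_var_comp, tupVal_var_comp]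
  | .tag V => by rw [Val.rename, Val.subst, Val.rename_eq_subst]
theorem Comp.rename_eq_subst (ζ ξ : ℕ → ℕ) : ∀ M : Comp,
    M.rename ζ ξ = M.subst (fun n => .var (ζ n)) (fun n => .var (ξ n))
  | .app V W => by rw [Comp.rename, Comp.subst, V.rename_eq_subst, W.rename_eq_subst]
  | .tapp V T => by rw [Comp.rename, Comp.subst, V.rename_eq_subst, T.rename_eq_subst]
  | .ret V E => by rw [Comp.rename, Comp.subst, V.rename_eq_subst, E.rename_eq_subst]
  | .perform l V E => by rw [Comp.rename, Comp.subst, V.rename_eq_subst, E.rename_eq_subst]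
  | .bind Y M N => by
    rw [Comp.rename, Comp.subst, M.rename_eq_subst, N.rename_eq_subst, upVal_var_comp]
  | .handle M H => by rw [Comp.rename, Comp.subst, M.rename_eq_subst, H.rename_eq_subst]
theorem Hnd.rename_eq_subst (ζ ξ : ℕ → ℕ) : ∀ H : Hnd,
    H.rename ζ ξ = H.subst (fun n => .var (ζ n)) (fun n => .var (ξ n))
  | .ret M => by rw [Hnd.rename, Hnd.subst, M.rename_eq_subst, upVal_var_comp]
  | .op l M H => by
    rw [Hnd.rename, Hnd.subst, M.rename_eq_subst, H.rename_eq_subst, upVal_var_comp,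
      upVal_var_comp]
end

theorem ValTy.subst_closed {V : Val} {A : Ty} (h : ValTy [] [] V A) (τ : ℕ → Ty) (σ : ℕ → Val) :
    V.subst τ σ = V :=
  h.subst_eq (fun _ h => nomatch h) (fun _ h => nomatch h)

theorem ValTy.rename_closed {V : Val} {A : Ty} (h : ValTy [] [] V A) (ζ ξ : ℕ → ℕ) :
    V.rename ζ ξ = V := by
  rw [Val.rename_eq_subst, h.subst_closed]

theorem HndTy.rename_closed {H : Hnd} {C D : Ty} (h : HndTy [] [] H C D) (ζ ξ : ℕ → ℕ) :
    H.rename ζ ξ = H := by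
  rw [Hnd.rename_eq_subst, h.subst_eq (fun _ h => nomatch h) (fun _ h => nomatch h)]

/-! ### Tag-safety -/

mutual
/-- Tag-safety of a value, an invariant that is defined by recursion and implies conditions 1 and 3:
tags are attached to closed values without unlimited type, and no tagged value occurs in an
unlimited abstraction or in a handler.  The parameter `c` says whether condition 4, which concerns
the continuations of unlimited sequencings, is included. -/
def Val.TagSafe (c : Prop) : Val → Prop
  | .var _ => True
  | .lam Y _ M => (Y = .unl → M.tl = 0) ∧ M.TagSafe c
  | .tlam Y _ M => (Y = .unl → M.tl = 0) ∧ M.TagSafe c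
  | .tag V => (∃ A, ValTy [] [] V A) ∧
      (∀ Δ Γ A, ValTy Δ Γ V A → ¬ Kinding Δ A (.type .unl)) ∧ V.TagSafe c
/-- Tag-safety of a computation; this is where condition 4 enters. -/
def Comp.TagSafe (c : Prop) : Comp → Prop
  | .app V W => V.TagSafe c ∧ W.TagSafe c
  | .tapp V _ => V.TagSafe c
  | .ret V _ => V.TagSafe c
  | .perform _ V _ => V.TagSafe c
  | .bind Y M N => (c → Y = .unl → N.tl = 0) ∧ M.TagSafe c ∧ N.TagSafe c
  | .handle M H => M.TagSafe c ∧ H.TagSafe c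
/-- Tag-safety of a handler, none of whose clauses may contain a tagged value. -/
def Hnd.TagSafe (c : Prop) : Hnd → Prop
  | .ret M => M.tl = 0 ∧ M.TagSafe c
  | .op _ M H => M.tl = 0 ∧ M.TagSafe c ∧ H.TagSafe c
end

theorem Hnd.TagSafe.tl_eq_zero {c : Prop} : ∀ {H : Hnd}, H.TagSafe c → H.tl = 0
  | .ret _, h => h.1
  | .op _ _ H, h => by rw [Hnd.tl, h.1, Hnd.TagSafe.tl_eq_zero (H := H) h.2.2, add_zero]

section Unlimited

variable {Δ Δ' : KCtx} {Γ Γ' : Ctx} {A B : Ty}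

theorem ValTy.lam_unl_iff {Y : Lin} {M : Comp} (h : ValTy Δ Γ (.lam Y A M) B) :
    Kinding Δ B (.type .unl) ↔ Y = .unl := by
  obtain ⟨_, hr, e⟩ := h.generation
  cases hr with | lam =>
  obtain ⟨_, _, rfl, -⟩ := e.arrow_inv
  exact h.kinding.arrow_unl_iff

theorem ValTy.tlam_unl_iff {Y : Lin} {K : Kind} {M : Comp} (h : ValTy Δ Γ (.tlam Y K M) B) :
    Kinding Δ B (.type .unl) ↔ Y = .unl := by
  obtain ⟨_, hr, e⟩ := h.generation
  cases hr with | tlam =>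
  obtain ⟨_, rfl, -⟩ := e.all_inv
  exact h.kinding.all_unl_iff

theorem ValTy.unl_iff_of_closed : ∀ {V : Val}, ValTy Δ [] V A → ValTy Δ' Γ' V B →
    (Kinding Δ A (.type .unl) ↔ Kinding Δ' B (.type .unl))
  | .var _, h, _ => by
    obtain ⟨_, hr, -⟩ := h.generation
    cases hr with | var hn => cases hn
  | .lam .., h, h' => h.lam_unl_iff.trans h'.lam_unl_iff.symm
  | .tlam .., h, h' => h.tlam_unl_iff.trans h'.tlam_unl_iff.symm
  | .tag _, h, h' => h.tag_inv.unl_iff_of_closed h'.tag_inv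

end Unlimited

section Mark

variable {c : Prop} {V : Val} {A : Ty}

theorem Val.TagSafe.tl_eq_zero {Δ : KCtx} {Γ : Ctx} (hV : V.TagSafe c) (h : ValTy Δ Γ V A)
    (hA : Kinding Δ A (.type .unl)) : V.tl = 0 := by
  cases V with
  | var => rfl
  | lam => exact hV.1 (h.lam_unl_iff.1 hA)
  | tlam => exact hV.1 (h.tlam_unl_iff.1 hA)
  | tag => exact absurd hA (hV.2.1 _ _ _ h.tag_inv)

theorem Val.tl_mark (V : Val) : V.mark.1.tl = V.tl + V.mark.2 := by
  rw [Val.mark]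
  split_ifs
  · exact add_comm _ _
  · exact (add_zero _).symm

theorem ValTy.mark (h : ValTy [] [] V A) : ValTy [] [] V.mark.1 A := by
  rw [Val.mark]
  split_ifs
  · exact h.tag
  · exact h

theorem Val.TagSafe.mark (hV : V.TagSafe c) : V.mark.1.TagSafe c := by
  rw [Val.mark]
  split_ifs with hm
  · obtain ⟨⟨A, hA, hn⟩, -⟩ := hm
    exact ⟨⟨A, hA⟩, fun _ _ _ h hu => hn ((hA.unl_iff_of_closed h).2 hu), hV⟩
  · exact hV

end Mark

/-- The part of the safety conditions that concerns the root of a term; the conditions on all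
subterms together are equivalent to `Term.TagSafe`.  Condition 4 is imposed only if `c` holds. -/
def Term.LocallySafe (c : Prop) : Term → Prop
  | .val W => (W.IsUnl → W.tl = 0) ∧ ∀ V, W = .tag V → ∃ A, ValTy [] [] V A
  | .comp M => c → ∀ N₁ N₂, M = .bind .unl N₁ N₂ → N₂.tl = 0
  | .hnd H => H.tl = 0

/-- `Val.TagSafe`, `Comp.TagSafe` and `Hnd.TagSafe` taken together, so that tag-safety can be passed
on to arbitrary subterms. -/
def Term.TagSafe (c : Prop) : Term → Prop
  | .val V => V.TagSafe c
  | .comp M => M.TagSafe c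
  | .hnd H => H.TagSafe c

mutual
theorem Val.tagSafe_of_locallySafe {c : Prop} : ∀ {V : Val},
    (∀ s, Term.Sub s (.val V) → s.LocallySafe c) → V.TagSafe c
  | .var _, _ => trivial
  | .lam Y A M, h =>
    ⟨fun hY => (h _ .refl).1 (.inl ⟨A, M, by rw [hY]⟩),
      Comp.tagSafe_of_locallySafe fun s hs => h s (.tail hs .lam)⟩
  | .tlam Y K M, h =>
    ⟨fun hY => (h _ .refl).1 (.inr (.inl ⟨K, M, by rw [hY]⟩)),
      Comp.tagSafe_of_locallySafe fun s hs => h s (.tail hs .tlam)⟩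
  | .tag V, h => by
    refine ⟨(h _ .refl).2 V rfl, fun Δ Γ A hA hK => ?_,
      Val.tagSafe_of_locallySafe fun s hs => h s (.tail hs .tag)⟩
    have := (h _ .refl).1 (.inr (.inr ⟨Δ, Γ, A, hA.tag, hK⟩))
    simp [Val.tl] at this
theorem Comp.tagSafe_of_locallySafe {c : Prop} : ∀ {M : Comp},
    (∀ s, Term.Sub s (.comp M) → s.LocallySafe c) → M.TagSafe c
  | .app V W, h => ⟨Val.tagSafe_of_locallySafe fun s hs => h s (.tail hs .app_left),
      Val.tagSafe_of_locallySafe fun s hs => h s (.tail hs .app_right)⟩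
  | .tapp V T, h => Val.tagSafe_of_locallySafe (V := V) fun s hs => h s (.tail hs .tapp)
  | .ret V E, h => Val.tagSafe_of_locallySafe (V := V) fun s hs => h s (.tail hs .ret)
  | .perform l V E, h => Val.tagSafe_of_locallySafe (V := V) fun s hs => h s (.tail hs .perform)
  | .bind Y M N, h =>
    ⟨fun hc hY => h _ .refl hc M N (by rw [hY]),
      Comp.tagSafe_of_locallySafe fun s hs => h s (.tail hs .bind_left),
      Comp.tagSafe_of_locallySafe fun s hs => h s (.tail hs .bind_right)⟩
  | .handle _ _, h => ⟨Comp.tagSafe_of_locallySafe fun s hs => h s (.tail hs .handle_left),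
      Hnd.tagSafe_of_locallySafe fun s hs => h s (.tail hs .handle_right)⟩
theorem Hnd.tagSafe_of_locallySafe {c : Prop} : ∀ {H : Hnd},
    (∀ s, Term.Sub s (.hnd H) → s.LocallySafe c) → H.TagSafe c
  | .ret _, h => ⟨h _ .refl, Comp.tagSafe_of_locallySafe fun s hs => h s (.tail hs .hret)⟩
  | .op _ _ _, h => ⟨(add_eq_zero.1 (h _ .refl)).1,
      Comp.tagSafe_of_locallySafe fun s hs => h s (.tail hs .hop),
      Hnd.tagSafe_of_locallySafe fun s hs => h s (.tail hs .hrest)⟩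
end

theorem Term.TagSafe.locallySafe {c : Prop} {t : Term} (h : t.TagSafe c) : t.LocallySafe c := by
  cases t with
  | val W =>
    refine ⟨?_, fun V hV => by subst hV; exact h.1⟩
    rintro (⟨A, N, rfl⟩ | ⟨K, N, rfl⟩ | ⟨Δ, Γ, A, hW, hA⟩)
    · exact h.1 rfl
    · exact h.1 rfl
    · exact Val.TagSafe.tl_eq_zero h hW hA
  | comp M => rintro hc N₁ N₂ rfl; exact h.1 hc rfl
  | hnd H => exact Hnd.TagSafe.tl_eq_zero h

theorem Term.TagSafe.child {c : Prop} {s t : Term} (h : t.TagSafe c) (hs : Term.Child s t) :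
    s.TagSafe c := by
  cases hs with
  | lam => exact h.2
  | tlam => exact h.2
  | tag => exact h.2.2
  | app_left => exact h.1
  | app_right => exact h.2
  | tapp => exact h
  | ret => exact h
  | perform => exact h
  | bind_left => exact h.2.1
  | bind_right => exact h.2.2
  | handle_left => exact h.1
  | handle_right => exact h.2
  | hret => exact h.2
  | hop => exact h.2.1
  | hrest => exact h.2.2

theorem Term.TagSafe.sub {c : Prop} {s t : Term} (h : t.TagSafe c) (hs : Term.Sub s t) :
    s.TagSafe c := by
  induction hs with
  | refl => exact h
  | tail _ hc ih => exact ih (h.child hc)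

theorem Comp.tagSafe_of_safe {c : Prop} {M : Comp} (ht : M.TagsClosed) (hv : M.UnlimitedValuesSafe)
    (hh : M.HandlersSafe) (hl : c → M.UnlimitedLetsSafe) : M.TagSafe c := by
  refine Comp.tagSafe_of_locallySafe fun s hs => ?_
  cases s with
  | val W => exact ⟨hv W hs, fun V hV => ht V (hV ▸ hs)⟩
  | comp N => exact fun hc N₁ N₂ hN => hl hc N₁ N₂ (hN ▸ hs)
  | hnd H => exact hh H hs

theorem Comp.TagSafe.tagsClosed {c : Prop} {M : Comp} (h : M.TagSafe c) : M.TagsClosed :=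
  fun V hV => (Term.TagSafe.sub (t := .comp M) h hV).locallySafe.2 V rfl

theorem Comp.TagSafe.unlimitedValuesSafe {c : Prop} {M : Comp} (h : M.TagSafe c) :
    M.UnlimitedValuesSafe :=
  fun _ hW => (Term.TagSafe.sub (t := .comp M) h hW).locallySafe.1

theorem Comp.TagSafe.handlersSafe {c : Prop} {M : Comp} (h : M.TagSafe c) : M.HandlersSafe :=
  fun _ hH => (Term.TagSafe.sub (t := .comp M) h hH).locallySafe

theorem Comp.TagSafe.unlimitedLetsSafe {M : Comp} (h : M.TagSafe True) : M.UnlimitedLetsSafe :=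
  fun N₁ N₂ hN => (Term.TagSafe.sub (t := .comp M) h hN).locallySafe trivial N₁ N₂ rfl

/-! ### Substitution of closed values -/

/-- The multiset of tagged values occurring in the values that `σ` assigns to the variables of `Γ`,
by which substitution along `σ` increases the tagged values of a term typed in `Γ`. -/
def Ctx.tl : Ctx → (ℕ → Val) → Multiset Val
  | [], _ => 0
  | none :: Γ, σ => Ctx.tl Γ fun n => σ (n + 1)
  | some _ :: Γ, σ => (σ 0).tl + Ctx.tl Γ fun n => σ (n + 1)

namespace Ctx

variable {Γ : Ctx} {σ : ℕ → Val}

theorem tl_eq_zero (h : ∀ n A, Γ[n]? = some (some A) → (σ n).tl = 0) : Ctx.tl Γ σ = 0 := by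
  induction Γ generalizing σ with
  | nil => rfl
  | cons A Γ ih =>
    have ih : Ctx.tl Γ (fun n => σ (n + 1)) = 0 := ih fun n A hA => h (n + 1) A hA
    cases A with
    | none => exact ih
    | some A => rw [Ctx.tl, ih, h 0 A rfl, add_zero]

theorem tl_eq_of_forall_ne {n : ℕ} {A : Ty} (hn : Γ[n]? = some (some A))
    (h : ∀ m B, m ≠ n → Γ[m]? = some (some B) → (σ m).tl = 0) : Ctx.tl Γ σ = (σ n).tl := by
  induction Γ generalizing σ n with
  | nil => cases hn
  | cons B Γ ih =>
    cases n with
    | zero =>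
      cases hn
      rw [Ctx.tl, tl_eq_zero fun m B hB => h (m + 1) B (Nat.succ_ne_zero m) hB, add_zero]
    | succ n =>
      have ih : Ctx.tl Γ (fun n => σ (n + 1)) = _ :=
        ih hn fun m B hm hB => h (m + 1) B (fun e => hm (Nat.succ.inj e)) hB
      cases B with
      | none => exact ih
      | some B => rw [Ctx.tl, ih, h 0 B (Nat.succ_ne_zero n).symm rfl, zero_add]

theorem tl_congr {σ' : ℕ → Val}
    (h : ∀ n A, Γ[n]? = some (some A) → (σ n).tl = (σ' n).tl) : Ctx.tl Γ σ = Ctx.tl Γ σ' := by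
  induction Γ generalizing σ σ' with
  | nil => rfl
  | cons A Γ ih =>
    have ih : Ctx.tl Γ (fun n => σ (n + 1)) = Ctx.tl Γ (fun n => σ' (n + 1)) :=
      ih fun n A hA => h (n + 1) A hA
    cases A with
    | none => exact ih
    | some A => rw [Ctx.tl, Ctx.tl, ih, h 0 A rfl]

theorem tl_tshift (Γ : Ctx) (σ : ℕ → Val) : Ctx.tl (Ctx.tshift Γ) σ = Ctx.tl Γ σ := by
  induction Γ generalizing σ with
  | nil => rfl
  | cons A Γ ih =>
    cases A with
    | none => exact ih _
    | some A => exact congrArg _ (ih _)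

theorem tl_split {Δ : KCtx} {Γ₁ Γ₂ : Ctx} (hs : Split Δ Γ Γ₁ Γ₂)
    (h : ∀ n A, Γ[n]? = some (some A) → Kinding Δ A (.type .unl) → (σ n).tl = 0) :
    Ctx.tl Γ σ = Ctx.tl Γ₁ σ + Ctx.tl Γ₂ σ := by
  induction hs generalizing σ with
  | nil => rfl
  | none _ ih => exact ih fun n A => h (n + 1) A
  | unl hA _ ih =>
    rw [Ctx.tl, Ctx.tl, Ctx.tl, ih fun n A => h (n + 1) A, h 0 _ rfl hA, zero_add, zero_add,
      zero_add]
  | linLeft _ _ ih => rw [Ctx.tl, Ctx.tl, Ctx.tl, ih fun n A => h (n + 1) A, add_assoc]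
  | linRight _ _ ih => rw [Ctx.tl, Ctx.tl, Ctx.tl, ih fun n A => h (n + 1) A, add_left_comm]

end Ctx

/-- A value substitution for `Γ` that fixes the innermost `k` variables, the ones bound by the term
under consideration, and replaces all other variables of `Γ` by closed values of the right types. -/
structure ClosingSubst (Γ : Ctx) (k : ℕ) (σ : ℕ → Val) : Prop where
  eq_var : ∀ n < k, σ n = .var n
  valTy : ∀ n A, k ≤ n → Γ[n]? = some (some A) → ValTy [] [] (σ n) A

namespace ClosingSubst

variable {Δ : KCtx} {Γ Γ₁ Γ₂ : Ctx} {k : ℕ} {σ : ℕ → Val}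

theorem rename_eq (h : ClosingSubst Γ k σ) {n : ℕ} {A : Ty} (hk : k ≤ n)
    (hn : Γ[n]? = some (some A)) (ζ ξ : ℕ → ℕ) : (σ n).rename ζ ξ = σ n :=
  (h.valTy n A hk hn).rename_closed ζ ξ

theorem left (h : ClosingSubst Γ k σ) (hs : Split Δ Γ Γ₁ Γ₂) : ClosingSubst Γ₁ k σ :=
  ⟨h.eq_var, fun n A hk hn => h.valTy n A hk (hs.get_left hn)⟩

theorem right (h : ClosingSubst Γ k σ) (hs : Split Δ Γ Γ₁ Γ₂) : ClosingSubst Γ₂ k σ :=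
  ⟨h.eq_var, fun n A hk hn => h.valTy n A hk (hs.get_right hn)⟩

theorem up (h : ClosingSubst Γ k σ) (A : Option Ty) :
    ClosingSubst (A :: Γ) (k + 1) (upVal σ) := by
  refine ⟨upVal_eq_var h.eq_var, ?_⟩
  rintro (_ | n) B hk hn
  · cases hk
  · have hk := Nat.le_of_succ_le_succ hk
    rw [upVal, h.rename_eq hk hn]
    exact h.valTy n B hk hn

theorem tup (h : ClosingSubst Γ k σ) : ClosingSubst (Ctx.tshift Γ) k (tupVal σ) := by
  refine ⟨tupVal_eq_var h.eq_var, fun n B hk hn => ?_⟩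
  rw [Ctx.tshift, List.getElem?_map] at hn
  match hG : Γ[n]?, hn with
  | some (some B'), hn =>
    cases hn
    have hB := h.valTy n B' hk hG
    rwa [tupVal, hB.rename_closed, hB.kinding.rename_eq fun _ h => nomatch h]

theorem nil : ClosingSubst [] 0 .var :=
  ⟨fun _ h => (nomatch h), fun _ _ _ h => nomatch h⟩

theorem single {V : Val} {A : Ty} (h : ValTy [] [] V A) :
    ClosingSubst [some A] 0 (FEff.single V) := by
  refine ⟨fun _ h => (nomatch h), ?_⟩
  rintro (_ | n) B - hn
  · cases hn; exact h
  · cases hn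

theorem double {V W : Val} {A B : Ty} (hV : ValTy [] [] V A) (hW : ValTy [] [] W B) :
    ClosingSubst [some B, some A] 0 (FEff.double V W) := by
  refine ⟨fun _ h => (nomatch h), ?_⟩
  rintro (_ | _ | n) B - hn
  · cases hn; exact hW
  · cases hn; exact hV
  · cases hn

end ClosingSubst

theorem ClosingSubst.var_subst {Δ Δ' : KCtx} {Γ : Ctx} {k n : ℕ} {σ : ℕ → Val} {τ : ℕ → Ty}
    {A : Ty} (hσ : ClosingSubst Γ k σ) (hτ : Kinding.Subst Δ Δ' τ) (hn : Γ[n]? = some (some A))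
    (hA : Kinding Δ A (.type .lin))
    (h : ∀ m B, m ≠ n → Γ[m]? = some (some B) → Kinding Δ B (.type .unl)) :
    ValTy Δ' (Ctx.tsubst τ (Γ.take k)) (σ n) (A.subst τ) := by
  have get {m : ℕ} {B : Ty} (hB : (Ctx.tsubst τ (Γ.take k))[m]? = some (some B)) :
      m < k ∧ ∃ B', Γ[m]? = some (some B') ∧ B = B'.subst τ := by
    rw [Ctx.tsubst, List.getElem?_map, List.getElem?_take] at hB
    split_ifs at hB with hm
    · match Γ[m]?, hB with
      | some (some B'), hB => cases hB; exact ⟨hm, B', rfl, rfl⟩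
    · cases hB
  rcases lt_or_ge n k with hk | hk
  · rw [hσ.eq_var n hk]
    refine .var ?_ (hA.subst hτ) fun m B hm hB => ?_
    · rw [Ctx.tsubst, List.getElem?_map, List.getElem?_take_of_lt hk, hn]; rfl
    · obtain ⟨-, B', hB', rfl⟩ := get hB
      exact (h m B' hm hB').subst hτ
  · have hV := hσ.valTy n A hk hn
    rw [hV.kinding.subst_eq fun _ h => nomatch h]
    refine hV.append (Δ' := Δ') fun B hB => ?_
    obtain ⟨m, hm⟩ := List.mem_iff_getElem?.1 hB
    obtain ⟨hmk, B', hB', rfl⟩ := get hm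
    exact (h m B' (by omega) hB').subst hτ

mutual
theorem ValTy.subst {Δ : KCtx} {Γ : Ctx} {V : Val} {A : Ty} :
    ValTy Δ Γ V A → ∀ {Δ' : KCtx} {τ : ℕ → Ty} {k : ℕ} {σ : ℕ → Val}, Kinding.Subst Δ Δ' τ →
      ClosingSubst Γ k σ → ValTy Δ' (Ctx.tsubst τ (Γ.take k)) (V.subst τ σ) (A.subst τ)
  | .var hn hA h, _, _, _, _, hτ, hσ => hσ.var_subst hτ hn hA h
  | .lam h hA hM, _, _, k, _, hτ, hσ =>
    .lam ((h.take k).subst hτ) (hA.subst hτ) (hM.subst hτ (hσ.up _))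
  | .tlam (K := K) h hM, _, τ, k, _, hτ, hσ => by
    refine .tlam ((h.take k).subst hτ) ?_
    have ih := hM.subst (hτ.up K) hσ.tup
    rwa [← Ctx.tshift_take, Ctx.tsubst_tshift] at ih
  | .tag h, _, _, _, _, hτ, hσ => .tag (h.subst hτ hσ)
  | .conv h e hB, _, τ, _, _, hτ, hσ => .conv (h.subst hτ hσ) (e.subst τ) (hB.subst hτ)
theorem CompTy.subst {Δ : KCtx} {Γ : Ctx} {M : Comp} {C : Ty} :
    CompTy Δ Γ M C → ∀ {Δ' : KCtx} {τ : ℕ → Ty} {k : ℕ} {σ : ℕ → Val}, Kinding.Subst Δ Δ' τ →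
      ClosingSubst Γ k σ → CompTy Δ' (Ctx.tsubst τ (Γ.take k)) (M.subst τ σ) (C.subst τ)
  | .app hs hV hW, _, _, k, _, hτ, hσ =>
    .app ((hs.take k).subst hτ) (hV.subst hτ (hσ.left hs)) (hW.subst hτ (hσ.right hs))
  | .tapp hV hT, _, _, _, _, hτ, hσ => by
    rw [Ty.inst_subst]
    exact .tapp (hV.subst hτ hσ) (hT.subst hτ)
  | .ret hV hE, _, _, _, _, hτ, hσ => .ret (hV.subst hτ hσ) (hE.subst hτ)
  | .perform e h hE hV, _, τ, _, _, hτ, hσ =>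
    .perform (e.subst τ) (h.subst hτ) (hE.subst hτ) (hV.subst hτ hσ)
  | .bind hs hM hN h hR, _, _, k, _, hτ, hσ =>
    .bind ((hs.take k).subst hτ) (hM.subst hτ (hσ.left hs)) (hN.subst hτ ((hσ.right hs).up _))
      ((h.take k).subst hτ) (hR.subst hτ)
  | .handle hs hH hM, _, _, k, _, hτ, hσ =>
    .handle ((hs.take k).subst hτ) (hH.subst hτ (hσ.left hs)) (hM.subst hτ (hσ.right hs))
  | .conv h e hD, _, τ, _, _, hτ, hσ => .conv (h.subst hτ hσ) (e.subst τ) (hD.subst hτ)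
theorem HndTy.subst {Δ : KCtx} {Γ : Ctx} {H : Hnd} {C D : Ty} :
    HndTy Δ Γ H C D → ∀ {Δ' : KCtx} {τ : ℕ → Ty} {k : ℕ} {σ : ℕ → Val}, Kinding.Subst Δ Δ' τ →
      ClosingSubst Γ k σ →
      HndTy Δ' (Ctx.tsubst τ (Γ.take k)) (H.subst τ σ) (C.subst τ) (D.subst τ)
  | .handler h hC hD hH, _, τ, k, _, hτ, hσ => by
    have hC := hC.subst hτ
    have hD := hD.subst hτ
    have hH := hH.subst hτ hσ
    simp only [Ty.subst, Ty.subst_opsRow, Ty.subst_presRow] at hC hD hH ⊢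
    exact .handler ((h.take k).subst hτ) hC hD hH
theorem ClausesTy.subst {Δ : KCtx} {Γ : Ctx} {H : Hnd} {A : Ty}
    {sigs : List (Label × Lin × Ty × Ty)} {D : Ty} :
    ClausesTy Δ Γ H A sigs D → ∀ {Δ' : KCtx} {τ : ℕ → Ty} {k : ℕ} {σ : ℕ → Val},
      Kinding.Subst Δ Δ' τ → ClosingSubst Γ k σ → ClausesTy Δ' (Ctx.tsubst τ (Γ.take k))
        (H.subst τ σ) (A.subst τ) (Ty.substSigs τ sigs) (D.subst τ)
  | .ret h, _, _, _, _, hτ, hσ => .ret (h.subst hτ (hσ.up _))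
  | .op h hH, _, _, _, _, hτ, hσ => .op (h.subst hτ ((hσ.up _).up _)) (hH.subst hτ hσ)
end

section Instantiation

variable {M : Comp} {V W : Val} {A B C T : Ty} {K : Kind}

theorem CompTy.inst (hM : CompTy [] [some A] M C) (hV : ValTy [] [] V A) :
    CompTy [] [] (M.inst V) C := by
  rw [← C.subst_var]
  exact hM.subst .var (.single hV)

theorem CompTy.inst₂ (hM : CompTy [] [some B, some A] M C) (hV : ValTy [] [] V A)
    (hW : ValTy [] [] W B) : CompTy [] [] (M.inst₂ V W) C := by
  rw [← C.subst_var]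
  exact hM.subst .var (.double hV hW)

theorem CompTy.tinst (hM : CompTy [K] [] M C) (hT : Kinding [] T K) :
    CompTy [] [] (M.tinst T) (C.inst T) :=
  hM.subst (.single hT) .nil

end Instantiation

/-- A closing substitution by tag-safe values; tag-safety is stable under these substitutions. -/
structure TagSafeClosingSubst (c : Prop) (Γ : Ctx) (k : ℕ) (σ : ℕ → Val) : Prop
    extends ClosingSubst Γ k σ where
  tagSafe : ∀ n A, Γ[n]? = some (some A) → (σ n).TagSafe c

namespace TagSafeClosingSubst

variable {c : Prop} {Δ : KCtx} {Γ Γ₁ Γ₂ : Ctx} {k : ℕ} {σ : ℕ → Val}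

theorem left (h : TagSafeClosingSubst c Γ k σ) (hs : Split Δ Γ Γ₁ Γ₂) :
    TagSafeClosingSubst c Γ₁ k σ :=
  ⟨h.toClosingSubst.left hs, fun n A hn => h.tagSafe n A (hs.get_left hn)⟩

theorem right (h : TagSafeClosingSubst c Γ k σ) (hs : Split Δ Γ Γ₁ Γ₂) :
    TagSafeClosingSubst c Γ₂ k σ :=
  ⟨h.toClosingSubst.right hs, fun n A hn => h.tagSafe n A (hs.get_right hn)⟩

theorem rename (h : TagSafeClosingSubst c Γ k σ) {n : ℕ} {A : Ty}
    (hn : Γ[n]? = some (some A)) (ζ ξ : ℕ → ℕ) :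
    ((σ n).rename ζ ξ).tl = (σ n).tl ∧ ((σ n).rename ζ ξ).TagSafe c := by
  rcases lt_or_ge n k with hk | hk
  · rw [h.eq_var n hk]; exact ⟨rfl, trivial⟩
  · rw [h.rename_eq hk hn]; exact ⟨rfl, h.tagSafe n A hn⟩

theorem up (h : TagSafeClosingSubst c Γ k σ) (A : Option Ty) :
    TagSafeClosingSubst c (A :: Γ) (k + 1) (upVal σ) := by
  refine ⟨h.toClosingSubst.up A, ?_⟩
  rintro (_ | n) B hn
  · exact trivial
  · exact (h.rename hn _ _).2

theorem tup (h : TagSafeClosingSubst c Γ k σ) :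
    TagSafeClosingSubst c (Ctx.tshift Γ) k (tupVal σ) := by
  refine ⟨h.toClosingSubst.tup, fun n B hn => ?_⟩
  rw [Ctx.tshift, List.getElem?_map] at hn
  match hG : Γ[n]?, hn with
  | some (some B'), _ => exact (h.rename hG _ _).2

theorem tl_eq_zero (h : TagSafeClosingSubst c Γ k σ) {n : ℕ} {A : Ty}
    (hn : Γ[n]? = some (some A)) (hA : Kinding Δ A (.type .unl)) : (σ n).tl = 0 := by
  rcases lt_or_ge n k with hk | hk
  · rw [h.eq_var n hk]; rfl
  · exact (h.tagSafe n A hn).tl_eq_zero ((h.valTy n A hk hn).append (Δ' := Δ) .nil) hA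

theorem ctx_tl_up (h : TagSafeClosingSubst c Γ k σ) (A : Ty) :
    Ctx.tl (some A :: Γ) (upVal σ) = Ctx.tl Γ σ := by
  rw [Ctx.tl, upVal, Val.tl, zero_add]
  exact Ctx.tl_congr fun n B hB => (h.rename hB _ _).1

theorem ctx_tl_tup (h : TagSafeClosingSubst c Γ k σ) :
    Ctx.tl (Ctx.tshift Γ) (tupVal σ) = Ctx.tl Γ σ := by
  rw [Ctx.tl_tshift]
  exact Ctx.tl_congr fun n B hB => (h.rename hB _ _).1

theorem ctx_tl_split (h : TagSafeClosingSubst c Γ k σ) (hs : Split Δ Γ Γ₁ Γ₂) :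
    Ctx.tl Γ σ = Ctx.tl Γ₁ σ + Ctx.tl Γ₂ σ :=
  Ctx.tl_split hs fun _ _ hn hA => h.tl_eq_zero hn hA

theorem ctx_tl_eq_zero (h : TagSafeClosingSubst c Γ k σ) (hΓ : CtxLin Δ Γ .unl) :
    Ctx.tl Γ σ = 0 :=
  Ctx.tl_eq_zero fun _ A hn => h.tl_eq_zero hn (hΓ A (List.mem_of_getElem? hn))

theorem nil : TagSafeClosingSubst c [] 0 .var := ⟨.nil, fun _ _ h => nomatch h⟩

theorem single {V : Val} {A : Ty} (h : ValTy [] [] V A) (hV : V.TagSafe c) :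
    TagSafeClosingSubst c [some A] 0 (FEff.single V) := by
  refine ⟨.single h, ?_⟩
  rintro (_ | n) B hn
  · exact hV
  · cases hn

theorem double {V W : Val} {A B : Ty} (hV : ValTy [] [] V A) (hW : ValTy [] [] W B)
    (hVs : V.TagSafe c) (hWs : W.TagSafe c) :
    TagSafeClosingSubst c [some B, some A] 0 (FEff.double V W) := by
  refine ⟨.double hV hW, ?_⟩
  rintro (_ | _ | n) B hn
  · exact hWs
  · exact hVs
  · cases hn

end TagSafeClosingSubst

-- Splitting gives a variable to both sides only if its type is unlimited, and then the value
-- substituted for it is tag-free; so tags are counted with the right multiplicity.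
mutual
theorem ValTy.tl_subst {c : Prop} {Δ : KCtx} {Γ : Ctx} {V : Val} {A : Ty} :
    ValTy Δ Γ V A → ∀ {k : ℕ} {σ : ℕ → Val} (τ : ℕ → Ty), TagSafeClosingSubst c Γ k σ →
      V.TagSafe c → (V.subst τ σ).tl = V.tl + Ctx.tl Γ σ
  | .var hn _ h, _, _, _, hσ, _ => by
    rw [Val.subst, Val.tl, zero_add,
      Ctx.tl_eq_of_forall_ne hn fun m B hm hB => hσ.tl_eq_zero hB (h m B hm hB)]
  | .lam _ _ hM, _, _, τ, hσ, hV => (hM.tl_subst τ (hσ.up _) hV.2).trans (by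
    rw [hσ.ctx_tl_up, Val.tl])
  | .tlam _ hM, _, _, τ, hσ, hV => (hM.tl_subst (Ty.upSubst τ) hσ.tup hV.2).trans (by
    rw [hσ.ctx_tl_tup, Val.tl])
  | .tag h, _, _, τ, hσ, hV => by
    obtain ⟨_, hA⟩ := hV.1
    have ih := h.tl_subst τ hσ hV.2.2
    rw [hA.subst_closed] at ih
    rw [Val.subst, hA.subst_closed, left_eq_add.1 ih, add_zero]
  | .conv h _ _, _, _, τ, hσ, hV => h.tl_subst τ hσ hV
theorem CompTy.tl_subst {c : Prop} {Δ : KCtx} {Γ : Ctx} {M : Comp} {C : Ty} :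
    CompTy Δ Γ M C → ∀ {k : ℕ} {σ : ℕ → Val} (τ : ℕ → Ty), TagSafeClosingSubst c Γ k σ →
      M.TagSafe c → (M.subst τ σ).tl = M.tl + Ctx.tl Γ σ
  | .app hs hV hW, _, _, τ, hσ, hM => by
    rw [Comp.subst, Comp.tl, Comp.tl, hV.tl_subst τ (hσ.left hs) hM.1,
      hW.tl_subst τ (hσ.right hs) hM.2, hσ.ctx_tl_split hs, add_add_add_comm]
  | .tapp hV _, _, _, τ, hσ, hM => hV.tl_subst τ hσ hM
  | .ret hV _, _, _, τ, hσ, hM => hV.tl_subst τ hσ hM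
  | .perform _ _ _ hV, _, _, τ, hσ, hM => hV.tl_subst τ hσ hM
  | .bind hs hM hN _ _, _, _, τ, hσ, h => by
    rw [Comp.subst, Comp.tl, Comp.tl, hM.tl_subst τ (hσ.left hs) h.2.1,
      hN.tl_subst τ ((hσ.right hs).up _) h.2.2, (hσ.right hs).ctx_tl_up, hσ.ctx_tl_split hs,
      add_add_add_comm]
  | .handle hs hH hM, _, _, τ, hσ, h => by
    rw [Comp.subst, Comp.tl, Comp.tl, hH.tl_subst τ (hσ.left hs) h.2,
      hM.tl_subst τ (hσ.right hs) h.1, hσ.ctx_tl_split hs, add_comm (Ctx.tl _ _),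
      add_add_add_comm]
  | .conv h _ _, _, _, τ, hσ, hM => h.tl_subst τ hσ hM
theorem HndTy.tl_subst {c : Prop} {Δ : KCtx} {Γ : Ctx} {H : Hnd} {C D : Ty} :
    HndTy Δ Γ H C D → ∀ {k : ℕ} {σ : ℕ → Val} (τ : ℕ → Ty), TagSafeClosingSubst c Γ k σ →
      H.TagSafe c → (H.subst τ σ).tl = H.tl + Ctx.tl Γ σ
  | .handler h _ _ hH, _, _, τ, hσ, hs => by
    have hΓ := hσ.ctx_tl_eq_zero h
    rw [hH.tl_subst τ hσ hΓ hs, hΓ, add_zero]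
theorem ClausesTy.tl_subst {c : Prop} {Δ : KCtx} {Γ : Ctx} {H : Hnd} {A : Ty}
    {sigs : List (Label × Lin × Ty × Ty)} {D : Ty} :
    ClausesTy Δ Γ H A sigs D → ∀ {k : ℕ} {σ : ℕ → Val} (τ : ℕ → Ty),
      TagSafeClosingSubst c Γ k σ → Ctx.tl Γ σ = 0 → H.TagSafe c → (H.subst τ σ).tl = H.tl
  | .ret h, _, _, τ, hσ, hΓ, hs => by
    rw [Hnd.subst, Hnd.tl, Hnd.tl, h.tl_subst τ (hσ.up _) hs.2, hσ.ctx_tl_up, hΓ, add_zero]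
  | .op h hH, _, _, τ, hσ, hΓ, hs => by
    rw [Hnd.subst, Hnd.tl, Hnd.tl, h.tl_subst τ ((hσ.up _).up _) hs.2.1, (hσ.up _).ctx_tl_up,
      hσ.ctx_tl_up, hH.tl_subst τ hσ hΓ hs.2.2, hΓ, add_zero]
end

mutual
theorem Val.TagSafe.subst {c : Prop} {Δ : KCtx} {Γ : Ctx} {V : Val} {A : Ty} :
    V.TagSafe c → ValTy Δ Γ V A → ∀ {k : ℕ} {σ : ℕ → Val} (τ : ℕ → Ty),
      TagSafeClosingSubst c Γ k σ → (V.subst τ σ).TagSafe c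
  | _, .var hn _ _, _, _, _, hσ => hσ.tagSafe _ _ hn
  | hV, .lam h _ hM, _, _, τ, hσ => by
    refine ⟨?_, hV.2.subst hM τ (hσ.up _)⟩
    rintro rfl
    rw [hM.tl_subst τ (hσ.up _) hV.2, hσ.ctx_tl_up, hV.1 rfl, hσ.ctx_tl_eq_zero h, add_zero]
  | hV, .tlam h hM, _, _, τ, hσ => by
    refine ⟨?_, hV.2.subst hM (Ty.upSubst τ) hσ.tup⟩
    rintro rfl
    rw [hM.tl_subst _ hσ.tup hV.2, hσ.ctx_tl_tup, hV.1 rfl, hσ.ctx_tl_eq_zero h, add_zero]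
  | hV, .tag _, _, _, _, _ => by
    obtain ⟨_, hA⟩ := hV.1
    rwa [Val.subst, hA.subst_closed]
  | hV, .conv h _ _, _, _, τ, hσ => hV.subst h τ hσ
theorem Comp.TagSafe.subst {c : Prop} {Δ : KCtx} {Γ : Ctx} {M : Comp} {C : Ty} :
    M.TagSafe c → CompTy Δ Γ M C → ∀ {k : ℕ} {σ : ℕ → Val} (τ : ℕ → Ty),
      TagSafeClosingSubst c Γ k σ → (M.subst τ σ).TagSafe c
  | h, .app hs hV hW, _, _, τ, hσ =>
    ⟨h.1.subst hV τ (hσ.left hs), h.2.subst hW τ (hσ.right hs)⟩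
  | h, .tapp hV _, _, _, τ, hσ => Val.TagSafe.subst h hV τ hσ
  | h, .ret hV _, _, _, τ, hσ => Val.TagSafe.subst h hV τ hσ
  | h, .perform _ _ _ hV, _, _, τ, hσ => Val.TagSafe.subst h hV τ hσ
  | h, .bind hs hM hN hΓ _, _, _, τ, hσ => by
    refine ⟨?_, h.2.1.subst hM τ (hσ.left hs), h.2.2.subst hN τ ((hσ.right hs).up _)⟩
    rintro hc rfl
    rw [hN.tl_subst τ ((hσ.right hs).up _) h.2.2, (hσ.right hs).ctx_tl_up, h.1 hc rfl,
      (hσ.right hs).ctx_tl_eq_zero hΓ, add_zero]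
  | h, .handle hs hH hM, _, _, τ, hσ =>
    ⟨h.1.subst hM τ (hσ.right hs), h.2.subst hH τ (hσ.left hs)⟩
  | h, .conv hM _ _, _, _, τ, hσ => h.subst hM τ hσ
theorem Hnd.TagSafe.subst {c : Prop} {Δ : KCtx} {Γ : Ctx} {H : Hnd} {C D : Ty} :
    H.TagSafe c → HndTy Δ Γ H C D → ∀ {k : ℕ} {σ : ℕ → Val} (τ : ℕ → Ty),
      TagSafeClosingSubst c Γ k σ → (H.subst τ σ).TagSafe c
  | hs, .handler h _ _ hH, _, _, τ, hσ => hs.subst_clauses hH τ hσ (hσ.ctx_tl_eq_zero h)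
theorem Hnd.TagSafe.subst_clauses {c : Prop} {Δ : KCtx} {Γ : Ctx} {H : Hnd} {A : Ty}
    {sigs : List (Label × Lin × Ty × Ty)} {D : Ty} :
    H.TagSafe c → ClausesTy Δ Γ H A sigs D → ∀ {k : ℕ} {σ : ℕ → Val} (τ : ℕ → Ty),
      TagSafeClosingSubst c Γ k σ → Ctx.tl Γ σ = 0 → (H.subst τ σ).TagSafe c
  | hs, .ret h, _, _, τ, hσ, hΓ => by
    refine ⟨?_, hs.2.subst h τ (hσ.up _)⟩
    rw [h.tl_subst τ (hσ.up _) hs.2, hσ.ctx_tl_up, hs.1, hΓ, add_zero]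
  | hs, .op h hH, _, _, τ, hσ, hΓ => by
    refine ⟨?_, hs.2.1.subst h τ ((hσ.up _).up _), hs.2.2.subst_clauses hH τ hσ hΓ⟩
    rw [h.tl_subst τ ((hσ.up _).up _) hs.2.1, (hσ.up _).ctx_tl_up, hσ.ctx_tl_up, hs.1, hΓ,
      add_zero]
end

section TagSafeInstantiation

variable {c : Prop} {M : Comp} {V W : Val} {A B C : Ty} {K : Kind}

theorem CompTy.tl_inst (h : CompTy [] [some A] M C) (hV : ValTy [] [] V A) (hMs : M.TagSafe c)
    (hVs : V.TagSafe c) : (M.inst V).tl = M.tl + V.tl := by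
  rw [Comp.inst, h.tl_subst Ty.var (.single hV hVs) hMs]
  exact congrArg _ (add_zero _)

theorem CompTy.tl_inst₂ (h : CompTy [] [some B, some A] M C) (hV : ValTy [] [] V A)
    (hW : ValTy [] [] W B) (hMs : M.TagSafe c) (hVs : V.TagSafe c) (hWs : W.TagSafe c) :
    (M.inst₂ V W).tl = M.tl + (V.tl + W.tl) := by
  rw [Comp.inst₂, h.tl_subst Ty.var (.double hV hW hVs hWs) hMs, add_comm V.tl]
  exact congrArg (fun S => M.tl + (W.tl + S)) (add_zero V.tl)

theorem CompTy.tl_tinst (h : CompTy [K] [] M C) (hMs : M.TagSafe c) (T : Ty) :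
    (M.tinst T).tl = M.tl :=
  (h.tl_subst (Ty.single T) .nil hMs).trans (add_zero _)

theorem Comp.TagSafe.inst (hMs : M.TagSafe c) (h : CompTy [] [some A] M C)
    (hV : ValTy [] [] V A) (hVs : V.TagSafe c) : (M.inst V).TagSafe c :=
  hMs.subst h Ty.var (.single hV hVs)

theorem Comp.TagSafe.inst₂ (hMs : M.TagSafe c) (h : CompTy [] [some B, some A] M C)
    (hV : ValTy [] [] V A) (hW : ValTy [] [] W B) (hVs : V.TagSafe c) (hWs : W.TagSafe c) :
    (M.inst₂ V W).TagSafe c :=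
  hMs.subst h Ty.var (.double hV hW hVs hWs)

theorem Comp.TagSafe.tinst (hMs : M.TagSafe c) (h : CompTy [K] [] M C) (T : Ty) :
    (M.tinst T).TagSafe c :=
  hMs.subst h (Ty.single T) .nil

end TagSafeInstantiation

/-! ### Handlers and evaluation contexts -/

section Clauses

variable {Δ : KCtx} {Γ : Ctx} {A D : Ty} {sigs : List (Label × Lin × Ty × Ty)}

theorem ClausesTy.retBody {H : Hnd} (h : ClausesTy Δ Γ H A sigs D) :
    CompTy Δ (some A :: Γ) H.retBody D := by
  induction H using Hnd.retBody.induct generalizing sigs with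
  | case1 => cases h; assumption
  | case2 _ _ H ih => cases h with | op _ h => exact ih h

theorem ClausesTy.clause {l : Label} {N : Comp} {H : Hnd} (h : ClausesTy Δ Γ H A sigs D)
    (hN : H.HasClause l N) : ∃ Y A' B', (l, Y, A', B') ∈ sigs ∧
      CompTy Δ (some (.arrow Y B' D) :: some A' :: Γ) N D := by
  induction H using Hnd.retBody.induct generalizing sigs with
  | case1 => exact hN.elim
  | case2 l' M H ih =>
    cases h with | op hM h =>
    rcases hN with ⟨rfl, rfl⟩ | hN
    · exact ⟨_, _, _, List.mem_cons_self, hM⟩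
    · obtain ⟨_, _, _, hm, hN⟩ := ih h hN
      exact ⟨_, _, _, List.mem_cons_of_mem _ hm, hN⟩

theorem ClausesTy.labels_subset_dom {H : Hnd} (h : ClausesTy Δ Γ H A sigs D) {l : Label}
    (hl : l ∈ sigs.map Prod.fst) : l ∈ H.dom := by
  induction H using Hnd.retBody.induct generalizing sigs with
  | case1 => cases h; cases hl
  | case2 l' M H ih =>
    cases h with | op _ h =>
    rcases List.mem_cons.1 hl with rfl | hl
    · exact Finset.mem_insert_self _ _
    · exact Finset.mem_insert_of_mem (ih h hl)

theorem HndTy.retBody {H : Hnd} {E : Ty} (h : HndTy Δ Γ H (.comp A E) D) :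
    CompTy Δ (some A :: Γ) H.retBody D := by
  cases h with | handler _ _ _ h => exact h.retBody

theorem HndTy.clause {H : Hnd} {R A₁ B₁ : Ty} {l : Label} {N : Comp} {Y : Lin}
    (h : HndTy Δ Γ H (.comp A (.eff R)) D) (hN : H.HasClause l N) (hR : R.RowHasOp l Y A₁ B₁) :
    ∃ A₂ B₂, Ty.Eqv A₂ A₁ ∧ Ty.Eqv B₂ B₁ ∧ Kinding Δ A₂ (.type .lin) ∧ Kinding Δ B₂ (.type .lin) ∧
      CompTy Δ (some (.arrow Y B₂ D) :: some A₂ :: Γ) N D := by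
  cases h with | handler _ hC _ h =>
  obtain ⟨-, _, hK⟩ := hC.comp_inv.2.2.eff_inv
  obtain ⟨Y', A₂, B₂, hm, hN⟩ := h.clause hN
  obtain ⟨rfl, hA, hB⟩ := Ty.RowHasOp.unique ⟨_, Ty.rowMem_opsRow hm, .refl _⟩ hR hK
  obtain ⟨-, hA₂, hB₂⟩ := ((Ty.rowMem_opsRow hm).kinding hK).op_inv
  exact ⟨A₂, B₂, hA, hB, hA₂, hB₂, hN⟩

end Clauses

section TagSafeClauses

variable {c : Prop} {H : Hnd}

theorem Hnd.TagSafe.retBody (h : H.TagSafe c) : H.retBody.tl = 0 ∧ H.retBody.TagSafe c := by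
  induction H using Hnd.retBody.induct with
  | case1 => exact h
  | case2 _ _ _ ih => exact ih h.2.2

theorem Hnd.TagSafe.clause {l : Label} {N : Comp} (h : H.TagSafe c) (hN : H.HasClause l N) :
    N.tl = 0 ∧ N.TagSafe c := by
  induction H using Hnd.retBody.induct with
  | case1 => exact hN.elim
  | case2 _ _ _ ih =>
    rcases hN with ⟨rfl, rfl⟩ | hN
    · exact ⟨h.1, h.2.1⟩
    · exact ih h.2.2 hN

end TagSafeClauses

theorem CompTy.bind_inv_of_closed {Y : Lin} {M N : Comp} {C : Ty}
    (h : CompTy [] [] (.bind Y M N) C) : ∃ A B R, CompTy [] [] M (.comp A (.eff R)) ∧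
      CompTy [] [some A] N (.comp B (.eff R)) ∧ Kinding [] R (.row ∅ Y) ∧
      Ty.Eqv (.comp B (.eff R)) C := by
  obtain ⟨_, hr, e⟩ := h.generation
  cases hr with | bind hs hM hN _ hR =>
  obtain ⟨rfl, rfl⟩ := hs.nil_inv
  exact ⟨_, _, _, hM, hN, hR, e⟩

theorem CompTy.handle_inv_of_closed {M : Comp} {H : Hnd} {D : Ty}
    (h : CompTy [] [] (.handle M H) D) : ∃ A R D', CompTy [] [] M (.comp A (.eff R)) ∧
      HndTy [] [] H (.comp A (.eff R)) D' ∧ Ty.Eqv D' D := by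
  obtain ⟨_, hr, e⟩ := h.generation
  cases hr with | handle hs hH hM =>
  obtain ⟨rfl, rfl⟩ := hs.nil_inv
  cases hH with | handler h hC hD hH => exact ⟨_, _, _, hM, .handler h hC hD hH, e⟩

theorem CtxLin.map_none {Δ : KCtx} {Y : Lin} (Γ : Ctx) :
    CtxLin Δ (Γ.map fun _ => none) Y := by
  intro A hA
  obtain ⟨_, -, h⟩ := List.mem_map.1 hA
  cases h

theorem Split.self_none {Δ : KCtx} {Γ : Ctx} (h : CtxLin Δ Γ .lin) :
    Split Δ Γ Γ (Γ.map fun _ => Option.none) ∧ Split Δ Γ (Γ.map fun _ => Option.none) Γ := by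
  induction Γ with
  | nil => exact ⟨.nil, .nil⟩
  | cons A Γ ih =>
    have ih := ih fun B hB => h B (List.mem_cons_of_mem _ hB)
    cases A with
    | none => exact ⟨.none ih.1, .none ih.2⟩
    | some A =>
      have hA := h A List.mem_cons_self
      exact ⟨.linLeft hA ih.1, .linRight hA ih.2⟩

namespace ECtx

theorem tl_plug (𝓔 : ECtx) (M : Comp) : (𝓔.plug M).tl = 𝓔.tl + M.tl := by
  induction 𝓔 with
  | hole => exact (zero_add _).symm
  | bind Y 𝓔 N ih => rw [plug, Comp.tl, ih, ECtx.tl, add_right_comm]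
  | handle 𝓔 H ih => rw [plug, Comp.tl, ih, ECtx.tl, add_right_comm]

theorem sub_plug (𝓔 : ECtx) (M : Comp) : Term.Sub (.comp M) (.comp (𝓔.plug M)) := by
  induction 𝓔 with
  | hole => exact .refl
  | bind Y 𝓔 N ih => exact .tail ih .bind_left
  | handle 𝓔 H ih => exact .tail ih .handle_left

theorem tagSafe_of_plug {c : Prop} {𝓔 : ECtx} {M : Comp} (h : (𝓔.plug M).TagSafe c) :
    M.TagSafe c :=
  Term.TagSafe.sub (s := .comp M) (t := .comp (𝓔.plug M)) h (𝓔.sub_plug M)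

theorem tagSafe_plug_of_plug {c : Prop} {𝓔 : ECtx} {M N : Comp} (h : (𝓔.plug M).TagSafe c)
    (hN : N.TagSafe c) : (𝓔.plug N).TagSafe c := by
  induction 𝓔 with
  | hole => exact hN
  | bind Y 𝓔 N ih => exact ⟨h.1, ih h.2.1, h.2.2⟩
  | handle 𝓔 H ih => exact ⟨ih h.1, h.2⟩

theorem shift_eq {𝓔 : ECtx} {M : Comp} {C : Ty} (h : CompTy [] [] (𝓔.plug M) C) :
    𝓔.shift = 𝓔 := by
  induction 𝓔 generalizing C with
  | hole => rfl
  | bind Y 𝓔 N ih =>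
    obtain ⟨A, B, R, hM, hN, -⟩ := h.bind_inv_of_closed
    rw [shift, ih hM, Comp.rename_eq_subst, hN.subst_eq fun _ h => nomatch h]
    rintro (_ | n) hn
    · rfl
    · exact absurd (Nat.lt_of_succ_lt_succ hn) (Nat.not_lt_zero n)
  | handle 𝓔 H ih =>
    obtain ⟨_, _, _, hM, hH, -⟩ := h.handle_inv_of_closed
    rw [shift, ih hM, hH.rename_closed]

theorem plug_inv {𝓔 : ECtx} {M : Comp} {C : Ty} (h : CompTy [] [] (𝓔.plug M) C) :
    ∃ C', CompTy [] [] M C' ∧ ∀ (Γ : Ctx) (N : Comp), CtxLin [] Γ .lin → CompTy [] Γ N C' →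
      CompTy [] Γ (𝓔.plug N) C := by
  induction 𝓔 generalizing C with
  | hole => exact ⟨C, h, fun _ _ _ h => h⟩
  | bind Y 𝓔 N ih =>
    obtain ⟨_, _, _, hM, hN, hR, e⟩ := h.bind_inv_of_closed
    obtain ⟨C', hM, ih⟩ := ih hM
    refine ⟨C', hM, fun Γ N' hΓ hN' => .conv (.bind (Split.self_none hΓ).1 (ih Γ N' hΓ hN') ?_
      (.map_none Γ) hR) e h.kinding⟩
    exact hN.append (Δ' := []) (.map_none Γ)
  | handle 𝓔 H ih =>
    obtain ⟨_, _, _, hM, hH, e⟩ := h.handle_inv_of_closed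
    obtain ⟨C', hM, ih⟩ := ih hM
    refine ⟨C', hM, fun Γ N' hΓ hN' => .conv (.handle (Split.self_none hΓ).2 ?_
      (ih Γ N' hΓ hN')) e h.kinding⟩
    exact hH.append (Δ' := []) (.map_none Γ)

section Perform

variable {𝓔 : ECtx} {Δ : KCtx} {Γ : Ctx} {l : Label} {V : Val} {E A B A₁ R : Ty} {Y : Lin}

theorem rowHasOp (h : CompTy Δ Γ (𝓔.plug (.perform l V E)) (.comp A₁ (.eff R)))
    (hE : E.HasOp l Y A B) (hl : l ∉ 𝓔.bl) : R.RowHasOp l Y A B := by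
  induction 𝓔 generalizing Γ A₁ R with
  | hole =>
    obtain ⟨_, hr, e⟩ := h.generation
    cases hr
    obtain ⟨R', rfl, hm⟩ := hE
    exact e.row_of_comp.rowHasOp_iff.1 ⟨_, hm, .refl _⟩
  | bind Y' 𝓔 N ih =>
    obtain ⟨_, hr, e⟩ := h.generation
    cases hr with | bind _ hM =>
    exact e.row_of_comp.rowHasOp_iff.1 (ih hM hl)
  | handle 𝓔 H ih =>
    rw [bl, Finset.mem_union, not_or] at hl
    obtain ⟨_, hr, e⟩ := h.generation
    cases hr with | handle _ hH hM =>
    cases hH with | handler _ _ _ hH =>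
    obtain ⟨P, hm, hP⟩ := ih hM hl.1
    exact e.row_of_comp.rowHasOp_iff.1
      ⟨P, hm.presRow_of_opsRow fun h => hl.2 (hH.labels_subset_dom h), hP⟩

/-- The row of a sequencing `let^Y` has kind `Row^Y`, hence the sequencings around an unlimited
operation are unlimited themselves. -/
theorem tl_eq_zero_of_unlimited {C : Ty} (h : CompTy Δ Γ (𝓔.plug (.perform l V E)) C)
    (hs : (𝓔.plug (.perform l V E)).TagSafe True) (hE : E.HasOp l .unl A B) (hl : l ∉ 𝓔.bl) :
    𝓔.tl = 0 := by
  induction 𝓔 generalizing Γ C with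
  | hole => rfl
  | bind Y 𝓔 N ih =>
    obtain ⟨_, hr, -⟩ := h.generation
    cases hr with | bind _ hM _ _ hR =>
    have hY : Y = .unl := ((rowHasOp hM hE hl).le hR).eq_unl
    rw [ECtx.tl, ih hM hs.2.1 hl, hs.1 trivial hY, add_zero]
  | handle 𝓔 H ih =>
    rw [bl, Finset.mem_union, not_or] at hl
    obtain ⟨_, hr, -⟩ := h.generation
    cases hr with | handle _ hH hM =>
    rw [ECtx.tl, ih hM hs.1 hl.1, hs.2.tl_eq_zero, add_zero]

end Perform

end ECtx

/-- The term has a type in some contexts.  For a handler, only its clauses are required to be typed,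
so that the property passes to all subterms. -/
def Term.Typed : Term → Prop
  | .val V => ∃ Δ Γ A, ValTy Δ Γ V A
  | .comp M => ∃ Δ Γ C, CompTy Δ Γ M C
  | .hnd H => ∃ Δ Γ A sigs D, ClausesTy Δ Γ H A sigs D

theorem ValTy.typed_child {Δ : KCtx} {Γ : Ctx} {V : Val} {A : Ty} (h : ValTy Δ Γ V A) {s : Term}
    (hs : Term.Child s (.val V)) : s.Typed := by
  obtain ⟨_, hr, -⟩ := h.generation
  cases hr with
  | var => cases hs
  | lam _ _ hM => cases hs; exact ⟨_, _, _, hM⟩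
  | tlam _ hM => cases hs; exact ⟨_, _, _, hM⟩
  | tag hV => cases hs; exact ⟨_, _, _, hV⟩

theorem CompTy.typed_child {Δ : KCtx} {Γ : Ctx} {M : Comp} {C : Ty} (h : CompTy Δ Γ M C)
    {s : Term} (hs : Term.Child s (.comp M)) : s.Typed := by
  obtain ⟨_, hr, -⟩ := h.generation
  cases hr with
  | app _ hV hW => cases hs; exacts [⟨_, _, _, hV⟩, ⟨_, _, _, hW⟩]
  | tapp hV => cases hs; exact ⟨_, _, _, hV⟩
  | ret hV => cases hs; exact ⟨_, _, _, hV⟩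
  | perform _ _ _ hV => cases hs; exact ⟨_, _, _, hV⟩
  | bind _ hM hN => cases hs; exacts [⟨_, _, _, hM⟩, ⟨_, _, _, hN⟩]
  | handle _ hH hM =>
    cases hH with | handler _ _ _ hH => cases hs; exacts [⟨_, _, _, hM⟩, ⟨_, _, _, _, _, hH⟩]

theorem ClausesTy.typed_child {Δ : KCtx} {Γ : Ctx} {H : Hnd} {A D : Ty}
    {sigs : List (Label × Lin × Ty × Ty)} (h : ClausesTy Δ Γ H A sigs D) {s : Term}
    (hs : Term.Child s (.hnd H)) : s.Typed := by
  cases h with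
  | ret hM => cases hs; exact ⟨_, _, _, hM⟩
  | op hM hH => cases hs; exacts [⟨_, _, _, hM⟩, ⟨_, _, _, _, _, hH⟩]

theorem Term.Typed.sub {s t : Term} (h : t.Typed) (hs : Term.Sub s t) : s.Typed := by
  induction hs with
  | refl => exact h
  | @tail _ t _ hc ih =>
    refine ih ?_
    match t, h with
    | .val _, ⟨_, _, _, h⟩ => exact h.typed_child hc
    | .comp _, ⟨_, _, _, h⟩ => exact h.typed_child hc
    | .hnd _, ⟨_, _, _, _, _, h⟩ => exact h.typed_child hc

theorem Comp.TagSafe.unlimitedContextsSafe {Δ : KCtx} {Γ : Ctx} {M : Comp} {C : Ty}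
    (h : M.TagSafe True) (hM : CompTy Δ Γ M C) : M.UnlimitedContextsSafe := by
  intro 𝓔 l V E A B hs hE hl
  obtain ⟨_, _, _, hM'⟩ := Term.Typed.sub (t := .comp M) ⟨_, _, _, hM⟩ hs
  exact ECtx.tl_eq_zero_of_unlimited hM' (Term.TagSafe.sub (t := .comp M) h hs) hE hl

theorem Comp.UnlimitedContextsSafe.of_plug {𝓔 : ECtx} {M : Comp}
    (h : (𝓔.plug M).UnlimitedContextsSafe) : M.UnlimitedContextsSafe :=
  fun 𝓔' l V E A B hs => h 𝓔' l V E A B (hs.trans (𝓔.sub_plug M))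

/-! ### Reduction -/

section RedexInversion

variable {V : Val} {M N : Comp} {H : Hnd} {A B C E T : Ty} {Y : Lin} {K : Kind}

theorem CompTy.beta_inv (h : CompTy [] [] (.app (.lam Y A M) V) C) :
    ValTy [] [] V A ∧ CompTy [] [some A] M C := by
  obtain ⟨_, hr, e⟩ := h.generation
  cases hr with | app hs hF hV =>
  obtain ⟨rfl, rfl⟩ := hs.nil_inv
  obtain ⟨_, hr, e'⟩ := hF.generation
  cases hr with | lam _ hA hM =>
  obtain ⟨_, _, hT, eA, eC⟩ := e'.arrow_inv
  cases hT
  exact ⟨.conv hV eA.symm hA, .conv hM (eC.trans e) h.kinding⟩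

theorem CompTy.tbeta_inv (h : CompTy [] [] (.tapp (.tlam Y K M) T) C) :
    ∃ C', CompTy [K] [] M C' ∧ Kinding [] T K ∧ Ty.Eqv (C'.inst T) C := by
  obtain ⟨_, hr, e⟩ := h.generation
  cases hr with | tapp hF hT =>
  obtain ⟨_, hr, e'⟩ := hF.generation
  cases hr with | tlam _ hM =>
  obtain ⟨_, hU, eC⟩ := e'.all_inv
  cases hU
  exact ⟨_, hM, hT, (eC.subst _).trans e⟩

theorem CompTy.ret_inv {Δ : KCtx} {Γ : Ctx} {E' : Ty} (h : CompTy Δ Γ (.ret V E) (.comp A E')) :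
    ValTy Δ Γ V A := by
  obtain ⟨_, hr, e⟩ := h.generation
  cases hr with | ret hV =>
  obtain ⟨_, _, hT, eA, -⟩ := e.comp_inv
  cases hT
  exact .conv hV eA h.kinding.comp_inv.2.1

theorem CompTy.bind_ret_inv (h : CompTy [] [] (.bind Y (.ret V E) N) C) :
    ∃ A, ValTy [] [] V A ∧ CompTy [] [some A] N C := by
  obtain ⟨_, _, _, hV, hN, -, e⟩ := h.bind_inv_of_closed
  exact ⟨_, hV.ret_inv, .conv hN e h.kinding⟩

theorem CompTy.handle_ret_inv (h : CompTy [] [] (.handle (.ret V E) H) C) :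
    ∃ A, ValTy [] [] V A ∧ CompTy [] [some A] H.retBody C := by
  obtain ⟨_, _, _, hV, hH, e⟩ := h.handle_inv_of_closed
  exact ⟨_, hV.ret_inv, .conv hH.retBody e h.kinding⟩

theorem CompTy.perform_inv {Δ : KCtx} {Γ : Ctx} {l : Label}
    (h : CompTy Δ Γ (.perform l V E) C) (hE : E.HasOp l Y A B) :
    ValTy Δ Γ V A ∧ Kinding Δ B (.type .lin) ∧ Kinding Δ E .effect ∧ Ty.Eqv (.comp B E) C := by
  obtain ⟨_, hr, e⟩ := h.generation
  cases hr with | perform e' hK hE' hV =>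
  obtain ⟨R, rfl, hm⟩ := hE
  obtain ⟨_, hT, eR⟩ := e'.eff_inv
  cases hT
  obtain ⟨-, _, hR⟩ := hK.eff_inv
  obtain ⟨-, _, hR'⟩ := hE'.eff_inv
  obtain ⟨rfl, eA, eB⟩ :=
    (Ty.rowHasOp_rowCons.2 (.inl ⟨rfl, .refl _⟩)).unique
      (eR.rowHasOp_iff.1 ⟨_, hm, .refl _⟩) hR
  obtain ⟨-, hA, hB⟩ := (hm.kinding hR').op_inv
  have eB : Ty.Eqv (.comp B (.eff R)) (.comp _ (.eff R)) := .comp eB.symm (.refl _)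
  exact ⟨.conv hV eA hA, hB, hE', eB.trans e⟩

end RedexInversion

/-- The continuation that is captured when the operation of result type `B` and effect type `E` in
the hole of `𝓔` is handled by `H`.  The handler is reinstalled, since handlers are deep, and the
context is weakened by the argument of the continuation. -/
def ECtx.resumption (𝓔 : ECtx) (Y : Lin) (B E : Ty) (H : Hnd) : Val :=
  .lam Y B (.handle (𝓔.shift.plug (.ret (.var 0) E)) (H.rename id Nat.succ))

namespace ECtx

variable {c : Prop} {𝓔 : ECtx} {l : Label} {V : Val} {H : Hnd} {Y : Lin} {A B C E : Ty}

theorem resumption_eq {M : Comp} (h : CompTy [] [] (.handle (𝓔.plug M) H) C) :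
    𝓔.resumption Y B E H = .lam Y B (.handle (𝓔.plug (.ret (.var 0) E)) H) := by
  obtain ⟨_, _, _, hM, hH, -⟩ := h.handle_inv_of_closed
  rw [resumption, shift_eq hM, hH.rename_closed]

theorem compTy_plug_ret (h : CompTy [] [] (𝓔.plug (.perform l V E)) C) (hE : E.HasOp l Y A B) :
    CompTy [] [some B] (𝓔.plug (.ret (.var 0) E)) C := by
  obtain ⟨_, hP, hrepl⟩ := plug_inv h
  obtain ⟨-, hB, hE, e⟩ := hP.perform_inv hE
  have hΓ : CtxLin [] [some B] .lin := fun T hT => by cases List.mem_singleton.1 hT; exact hB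
  have hvar : ValTy [] [some B] (.var 0) B := by
    refine .var rfl hB ?_
    rintro (_ | m) T hm hT
    · exact absurd rfl hm
    · cases hT
  exact hrepl _ _ hΓ (.conv (.ret hvar hE) e hP.kinding)

theorem resumption_valTy {D : Ty} (hM : CompTy [] [] (𝓔.plug (.perform l V E)) C)
    (hH : HndTy [] [] H C D) (hE : E.HasOp l Y A B) :
    ValTy [] [] (𝓔.resumption Y B E H) (.arrow Y B D) := by
  rw [resumption_eq (.handle .nil hH hM)]
  obtain ⟨_, hP, -⟩ := plug_inv hM
  obtain ⟨-, hB, -⟩ := hP.perform_inv hE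
  have hH' : HndTy [] [none] H C D := hH.append (Δ' := []) (.map_none [none])
  exact .lam .nil hB (.handle (.linRight hB .nil) hH' (compTy_plug_ret hM hE))

theorem resumption_tagSafe (h : CompTy [] [] (.handle (𝓔.plug (.perform l V E)) H) C)
    (hs : (Comp.handle (𝓔.plug (.perform l V E)) H).TagSafe c)
    (hu : (Comp.handle (𝓔.plug (.perform l V E)) H).UnlimitedContextsSafe)
    (hl : l ∉ 𝓔.bl) (hE : E.HasOp l Y A B) : (𝓔.resumption Y B E H).TagSafe c := by
  rw [resumption_eq h]
  refine ⟨?_, tagSafe_plug_of_plug (N := .ret (.var 0) E) hs.1 trivial, hs.2⟩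
  rintro rfl
  rw [Comp.tl, tl_plug, hu 𝓔 l V E A B (.single .handle_left) hE hl, hs.2.tl_eq_zero]
  rfl

theorem resumption_tl (h : CompTy [] [] (.handle (𝓔.plug (.perform l V E)) H) C)
    (hs : H.TagSafe c) : (𝓔.resumption Y B E H).tl = 𝓔.tl := by
  rw [resumption_eq h, Val.tl, Comp.tl, tl_plug, hs.tl_eq_zero, add_zero]
  exact add_zero _

end ECtx

theorem CompTy.handle_perform_inv {𝓔 : ECtx} {l : Label} {V : Val} {H : Hnd} {N : Comp} {Y : Lin}
    {A B C E : Ty} (h : CompTy [] [] (.handle (𝓔.plug (.perform l V E)) H) C)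
    (hl : l ∉ 𝓔.bl) (hN : H.HasClause l N) (hE : E.HasOp l Y A B) :
    ∃ A' K, CompTy [] [some K, some A'] N C ∧ ValTy [] [] V A' ∧
      ValTy [] [] (𝓔.resumption Y B E H) K := by
  obtain ⟨_, _, D, hM, hH, e⟩ := h.handle_inv_of_closed
  obtain ⟨A', B', eA, eB, hA, hB, hN⟩ := hH.clause hN (ECtx.rowHasOp hM hE hl)
  obtain ⟨_, hP, -⟩ := ECtx.plug_inv hM
  obtain ⟨hV, -⟩ := hP.perform_inv hE
  exact ⟨A', .arrow Y B' D, .conv hN e h.kinding, .conv hV eA.symm hA,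
    .conv (ECtx.resumption_valTy hM hH hE) (.arrow eB.symm (.refl _)) (.arrow hB hH.kinding)⟩

theorem CompTy.fctx_untag {Δ : KCtx} {Γ : Ctx} {F : FCtx} {V : Val} {C : Ty}
    (h : CompTy Δ Γ (F.plug (.tag V)) C) : CompTy Δ Γ (F.plug V) C := by
  obtain ⟨_, hr, e⟩ := h.generation
  cases F with
  | app W => cases hr with | app hs hV hW => exact .conv (.app hs hV.tag_inv hW) e h.kinding
  | tapp T => cases hr with | tapp hV hT => exact .conv (.tapp hV.tag_inv hT) e h.kinding

namespace Step

variable {c : Prop} {M N : Comp} {S T : Multiset Val} {C : Ty}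

theorem compTy (h : Step M S T N) (hM : CompTy [] [] M C) : CompTy [] [] N C := by
  induction h generalizing C with
  | app => obtain ⟨hV, hM⟩ := hM.beta_inv; exact hM.inst hV.mark
  | tapp => obtain ⟨_, hF, hT, e⟩ := hM.tbeta_inv; exact .conv (hF.tinst hT) e hM.kinding
  | seq => obtain ⟨_, hV, hN⟩ := hM.bind_ret_inv; exact hN.inst hV.mark
  | ret => obtain ⟨_, hV, hN⟩ := hM.handle_ret_inv; exact hN.inst hV.mark
  | op hl hN hE hW =>
    subst hW
    obtain ⟨_, _, hN, hV, hW⟩ := hM.handle_perform_inv hl hN hE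
    exact hN.inst₂ hV.mark hW.mark
  | remove => exact hM.fctx_untag
  | lift _ ih =>
    obtain ⟨_, hM, hrepl⟩ := ECtx.plug_inv hM
    exact hrepl [] _ .nil (ih hM)

theorem tagSafe (h : Step M S T N) (hM : CompTy [] [] M C) (hs : M.TagSafe c)
    (hu : M.UnlimitedContextsSafe) : N.TagSafe c := by
  induction h generalizing C with
  | app => obtain ⟨hV, hM⟩ := hM.beta_inv; exact hs.1.2.inst hM hV.mark hs.2.mark
  | tapp => obtain ⟨_, hM, -⟩ := hM.tbeta_inv; exact Comp.TagSafe.tinst hs.2 hM _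
  | seq => obtain ⟨_, hV, hN⟩ := hM.bind_ret_inv; exact hs.2.2.inst hN hV.mark hs.2.1.mark
  | ret =>
    obtain ⟨_, hV, hN⟩ := hM.handle_ret_inv
    exact hs.2.retBody.2.inst hN hV.mark (Val.TagSafe.mark hs.1)
  | op hl hN hE hW =>
    subst hW
    obtain ⟨_, _, hN', hV, hW⟩ := hM.handle_perform_inv hl hN hE
    have hWs := ECtx.resumption_tagSafe hM hs hu hl hE
    exact (hs.2.clause hN).2.inst₂ hN' hV.mark hW.mark (ECtx.tagSafe_of_plug hs.1).mark hWs.mark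
  | @remove F V =>
    cases F with
    | app W => exact ⟨hs.1.2.2, hs.2⟩
    | tapp T => exact hs.2.2
  | lift _ ih =>
    obtain ⟨_, hM, -⟩ := ECtx.plug_inv hM
    exact ECtx.tagSafe_plug_of_plug hs (ih hM (ECtx.tagSafe_of_plug hs) hu.of_plug)

theorem tl_add (h : Step M S T N) (hM : CompTy [] [] M C) (hs : M.TagSafe c)
    (hu : M.UnlimitedContextsSafe) : M.tl + S = N.tl + T := by
  induction h generalizing C with
  | app =>
    obtain ⟨hV, hM⟩ := hM.beta_inv
    rw [hM.tl_inst hV.mark hs.1.2 hs.2.mark, Val.tl_mark, add_zero, ← add_assoc]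
    rfl
  | tapp => obtain ⟨_, hM, -⟩ := hM.tbeta_inv; rw [hM.tl_tinst hs.2]; rfl
  | seq =>
    obtain ⟨_, hV, hN⟩ := hM.bind_ret_inv
    rw [hN.tl_inst hV.mark hs.2.2 hs.2.1.mark, Val.tl_mark, add_zero, ← add_assoc,
      add_comm (Comp.tl _) (Val.tl _)]
    rfl
  | ret =>
    obtain ⟨_, hV, hN⟩ := hM.handle_ret_inv
    obtain ⟨hN0, hNs⟩ := hs.2.retBody
    rw [hN.tl_inst hV.mark hNs (Val.TagSafe.mark hs.1), Val.tl_mark, hN0, Comp.tl, hs.2.tl_eq_zero,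
      add_zero, add_zero, zero_add]
    rfl
  | op hl hN hE hW =>
    obtain rfl : _ = ECtx.resumption _ _ _ _ _ := hW
    obtain ⟨_, _, hN', hV, hW⟩ := hM.handle_perform_inv hl hN hE
    have hWs := ECtx.resumption_tagSafe hM hs hu hl hE
    obtain ⟨hN0, hNs⟩ := hs.2.clause hN
    rw [hN'.tl_inst₂ hV.mark hW.mark hNs (ECtx.tagSafe_of_plug hs.1).mark hWs.mark, hN0,
      Val.tl_mark, Val.tl_mark, ECtx.resumption_tl hM hs.2, Comp.tl, ECtx.tl_plug, Comp.tl,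
      hs.2.tl_eq_zero]
    abel
  | @remove F V =>
    cases F with
    | app W => rw [FCtx.plug, Comp.tl, Val.tl, add_zero, add_assoc, add_comm]; rfl
    | tapp T => rw [FCtx.plug, Comp.tl, Val.tl, add_zero, add_comm]; rfl
  | lift _ ih =>
    obtain ⟨_, hM, -⟩ := ECtx.plug_inv hM
    rw [ECtx.tl_plug, ECtx.tl_plug, add_assoc, add_assoc,
      ih hM (ECtx.tagSafe_of_plug hs) hu.of_plug]

end Step

end FEff

theorem mainTheorem1 (M N : FEff.Comp) (C : FEff.Ty) (S T : Multiset FEff.Val)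
    (htyped : FEff.CompTy [] [] M C) (htags : M.TagsClosed) (hsafe : M.LinearSafe)
    (hstep : FEff.Step M S T N) :
    M.tl + S = N.tl + T ∧
    FEff.CompTy [] [] N C ∧ N.TagsClosed ∧
    N.UnlimitedValuesSafe ∧ N.HandlersSafe ∧
    (M.UnlimitedLetsSafe → N.LinearSafe ∧ N.UnlimitedLetsSafe) := by
  have hN := hstep.compTy htyped
  have tagSafe (c : Prop) (hc : c → M.UnlimitedLetsSafe) : M.TagSafe c :=
    FEff.Comp.tagSafe_of_safe htags hsafe.values hsafe.handlers hc
  have hM := tagSafe False False.elim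
  have hNs := hstep.tagSafe htyped hM hsafe.contexts
  refine ⟨hstep.tl_add htyped hM hsafe.contexts, hN, hNs.tagsClosed, hNs.unlimitedValuesSafe,
    hNs.handlersSafe, fun hlets => ?_⟩
  have hNs' := hstep.tagSafe htyped (tagSafe True fun _ => hlets) hsafe.contexts
  exact ⟨⟨hNs.unlimitedValuesSafe, hNs'.unlimitedContextsSafe hN, hNs.handlersSafe⟩,
    hNs'.unlimitedLetsSafe⟩
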